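/- Let $\Lambda$ be an artin algebra (a ring that is an algebra over some commutative artinian ring $k$ and is finitely generated as a $k$-module). Let $\Lambda\text{-Mod}$ be the category of all left $\Lambda$-modules and $\Lambda\text{-mod}$ its full subcategory of finitely generated modules. For a full subcategory $\mathcal X$ of an abelian category $\mathcal A$: $\mathcal X$ is *generating* (resp. *cogenerating*) if every object of $\mathcal A$ is a quotient (resp. a subobject) of an object of $\mathcal X$; $\mathcal X$ is *functorially finite* if for every object $A$ of $\mathcal A$ there are a morphism $\theta: X\to A$ with $X\in\mathcal X$ through which every morphism from an object of $\mathcal X$ to $A$ factors, and a morphism $\theta': A\to X'$ with $X'\in\mathcal X$ through which every morphism from $A$ to an object of $\mathcal X$ factors. The subcategory $\mathcal X$ is *$n$-cluster tilting* if it is generating, cogenerating and functorially finite in $\mathcal A$ and $$\mathcal X=\{Y\in\mathcal A \mid \mathrm{Ext}^i_{\mathcal A}(\mathcal X,Y)=0 \text{ for all } 0<i<n\}=\{Y\in\mathcal A \mid \mathrm{Ext}^i_{\mathcal A}(Y,\mathcal X)=0 \text{ for all } 0<i<n\}.$$ Let $n\ge 2$ and let $\mathcal M$ be an $n$-cluster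 tilting subcategory of $\Lambda\text{-mod}$. Let $\mathrm{Add}(\mathcal M)$ be the full subcategory of $\Lambda\text{-Mod}$ of all direct summands of arbitrary direct sums of objects of $\mathcal M$, and let $\varinjlim\mathcal M$ be the full subcategory of $\Lambda\text{-Mod}$ of all filtered colimits (direct limits) of objects of $\mathcal M$. Then: (a) $\varinjlim\mathcal M$ is a generating and cogenerating subcategory of $\Lambda\text{-Mod}$. (b) $\varinjlim\mathcal M$ is a functorially finite subcategory of $\Lambda\text{-Mod}$. (c) $\mathrm{Ext}^k_\Lambda(X,Y)=0$ for all $X\in\mathrm{Add}(\mathcal M)$, $Y\in\varinjlim\mathcal M$ and $k\in\{1,\dots,n-1\}$. (d) $\{X\in\Lambda\text{-Mod}\mid \mathrm{Ext}^i_\Lambda(\mathcal M,X)=0 \text{ for all } 0<i<n\}\subseteq\varinjlim\mathcal M$. -/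

import Mathlib

universe w v u

open CategoryTheory Limits Abelian

/-- A ring `Λ` is an *artin algebra* if it is an algebra over some commutative artinian ring `k`
and is finitely generated as a `k`-module. -/
class IsArtinAlgebra (Λ : Type u) [Ring Λ] : Prop where
  exists_base : ∃ (k : Type u) (_ : CommRing k) (_ : Algebra k Λ),
    IsArtinianRing k ∧ Module.Finite k Λ

instance IsArtinAlgebra.isNoetherianRing (Λ : Type u) [Ring Λ] [h : IsArtinAlgebra Λ] :
    IsNoetherianRing Λ := by
  obtain ⟨k, _, _, _, _⟩ := h.exists_base
  exact isNoetherian_of_tower k inferInstance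

section Subcategories

/- Full subcategories of a category `A` are given by properties of objects of `A`. -/

variable {A : Type u} [Category.{v} A]

/-- Every object of `A` is a quotient of an object in `M`. -/
def IsGeneratingSubcategory (M : ObjectProperty A) : Prop :=
  ∀ X : A, ∃ (Y : A) (p : Y ⟶ X), M Y ∧ Epi p

/-- Every object of `A` is a subobject of an object in `M`. -/
def IsCogeneratingSubcategory (M : ObjectProperty A) : Prop :=
  ∀ X : A, ∃ (Y : A) (i : X ⟶ Y), M Y ∧ Mono i

/-- `θ : Y ⟶ X` is a right `M`-approximation of `X`: `Y` lies in `M` and every morphism from an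
object of `M` to `X` factors through `θ`. -/
def IsRightApproximation (M : ObjectProperty A) {Y X : A} (θ : Y ⟶ X) : Prop :=
  M Y ∧ ∀ ⦃Z : A⦄, M Z → ∀ f : Z ⟶ X, ∃ g : Z ⟶ Y, g ≫ θ = f

/-- `θ : X ⟶ Y` is a left `M`-approximation of `X`: `Y` lies in `M` and every morphism from `X` to
an object of `M` factors through `θ`. -/
def IsLeftApproximation (M : ObjectProperty A) {X Y : A} (θ : X ⟶ Y) : Prop :=
  M Y ∧ ∀ ⦃Z : A⦄, M Z → ∀ f : X ⟶ Z, ∃ g : Y ⟶ Z, θ ≫ g = f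

/-- Every object of `A` has a right `M`-approximation. -/
def IsContravariantlyFinite (M : ObjectProperty A) : Prop :=
  ∀ X : A, ∃ (Y : A) (θ : Y ⟶ X), IsRightApproximation M θ

/-- Every object of `A` has a left `M`-approximation. -/
def IsCovariantlyFinite (M : ObjectProperty A) : Prop :=
  ∀ X : A, ∃ (Y : A) (θ : X ⟶ Y), IsLeftApproximation M θ

/-- `M` is both contravariantly and covariantly finite in `A`. -/
def IsFunctoriallyFinite (M : ObjectProperty A) : Prop :=
  IsContravariantlyFinite M ∧ IsCovariantlyFinite M

section Ext

variable [Abelian A] [HasExt.{w} A]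

/-- `M^{⊥ₙ}`: the objects `Y` with `Ext^i(X, Y) = 0` for all `X` in `M` and `0 < i < n`. -/
def rightPerp (M : ObjectProperty A) (n : ℕ) : ObjectProperty A :=
  fun Y => ∀ ⦃X : A⦄, M X → ∀ i : ℕ, 0 < i → i < n → Subsingleton (Ext.{w} X Y i)

/-- `^{⊥ₙ}M`: the objects `X` with `Ext^i(X, Y) = 0` for all `Y` in `M` and `0 < i < n`. -/
def leftPerp (M : ObjectProperty A) (n : ℕ) : ObjectProperty A :=
  fun X => ∀ ⦃Y : A⦄, M Y → ∀ i : ℕ, 0 < i → i < n → Subsingleton (Ext.{w} X Y i)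

/-- `M` is an `n`-cluster tilting subcategory of the abelian category `A`. -/
structure IsClusterTilting (M : ObjectProperty A) (n : ℕ) : Prop where
  generating : IsGeneratingSubcategory M
  cogenerating : IsCogeneratingSubcategory M
  functoriallyFinite : IsFunctoriallyFinite M
  rightPerp_eq : rightPerp.{w} M n = M
  leftPerp_eq : leftPerp.{w} M n = M

end Ext

end Subcategories

section Modules

variable {Λ : Type u} [Ring Λ]

/-- The finite free module `Λ^m` is projective in the category of finitely generated modules. -/
lemma FGModuleCat.projective_of_fin [IsNoetherianRing Λ] (m : ℕ) :
    Projective (FGModuleCat.of Λ (Fin m → Λ)) where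
  factors {E X} f e he := by
    have hs : Function.Surjective e.hom.hom := by
      have : Epi ((forget₂ (FGModuleCat.{u} Λ) (ModuleCat.{u} Λ)).map e) := inferInstance
      exact (ModuleCat.epi_iff_surjective _).1 this
    obtain ⟨g, hg⟩ := Module.projective_lifting_property e.hom.hom f.hom.hom hs
    exact ⟨ObjectProperty.homMk (ModuleCat.ofHom g), FGModuleCat.hom_ext hg⟩

instance FGModuleCat.enoughProjectives [IsNoetherianRing Λ] :
    EnoughProjectives (FGModuleCat.{u} Λ) where
  presentation X := by
    obtain ⟨m, f, hf⟩ := Module.Finite.exists_fin' Λ X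
    let p : FGModuleCat.of Λ (Fin m → Λ) ⟶ X := ObjectProperty.homMk (ModuleCat.ofHom f)
    have hp : Epi ((ModuleCat.isFG Λ).ι.map p) := (ModuleCat.epi_iff_surjective _).2 hf
    exact ⟨{ p := _, projective := FGModuleCat.projective_of_fin m, f := p,
             epi := (ModuleCat.isFG Λ).ι.epi_of_epi_map hp }⟩

instance FGModuleCat.hasExt [IsNoetherianRing Λ] : HasExt.{u} (FGModuleCat.{u} Λ) :=
  hasExt_of_enoughProjectives.{u} (FGModuleCat.{u} Λ)

/-- A full subcategory `M` of `Λ`-mod, regarded as a full subcategory of `Λ`-Mod (closed under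
isomorphisms). -/
def inMod (M : ObjectProperty (FGModuleCat.{u} Λ)) : ObjectProperty (ModuleCat.{u} Λ) :=
  M.map (ModuleCat.isFG Λ).ι

/-- `Add(M)`: the direct summands in `Λ`-Mod of arbitrary direct sums of objects of `M`. -/
def addClosure (M : ObjectProperty (FGModuleCat.{u} Λ)) : ObjectProperty (ModuleCat.{u} Λ) :=
  fun X => ∃ (I : Type u) (Y : I → FGModuleCat.{u} Λ), (∀ i, M (Y i)) ∧
    Nonempty (Retract X (∐ fun i => (Y i).obj))

/-- `lim→ M`: the filtered colimits in `Λ`-Mod of objects of `M`. -/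
def limClosure (M : ObjectProperty (FGModuleCat.{u} Λ)) : ObjectProperty (ModuleCat.{u} Λ) :=
  ObjectProperty.ind.{u} (inMod M)

end Modules

/-! Everything rests on one criterion, `limClosure_iff_factors`: a module X lies in L = `limClosure
M` iff every morphism from a finitely generated module F to X factors through M. Equivalently, X is
injective with respect to the left M-approximations F → N. So L consists of the injectives for a set
of maps, and the small object argument makes L covariantly finite. For (d), embed F in its
M-approximation; a morphism F → X extends once Ext^1(cokernel, X) = 0. Repeated cosyzygies shift
this to Ext^{n-1} of an object of M, which vanishes. Part (c) reduces to Ext(M, L) = 0, obtained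
from free presentations and factorization through M. Generation comes from coproducts of objects of
M, cogeneration from injective modules, which lie in L by (d). Contravariant finiteness is the hard
part. For X in L the double character dual X^{++} is again in L, the evaluation X → X^{++} is pure
with cokernel in L, and pure-injectivity of X^{++} gives Ext^i(L, X^{++}) = 0 for 0 < i < n.
Starting from these sequences, Salce's pushout trick and a downward induction on the degree produce
short exact sequences 0 → K → P → X → 0 with P in L and Ext^1(L, K) = 0, so that P → X is a right
L-approximation. -/

namespace CategoryTheory.ShortComplex.ShortExact

/-! ### Dimension shifting for Ext. -/

variable {A : Type u} [Category.{v} A] [Abelian A] [HasExt.{w} A] {S : ShortComplex A}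
  (hS : S.ShortExact)

include hS

lemma subsingleton_ext_left (X : A) {i : ℕ} (h₃ : Subsingleton (Ext.{w} X S.X₃ i))
    (h₂ : Subsingleton (Ext.{w} X S.X₂ (i + 1))) : Subsingleton (Ext.{w} X S.X₁ (i + 1)) := by
  refine subsingleton_of_forall_eq 0 fun x => ?_
  obtain ⟨y, rfl⟩ := Ext.covariant_sequence_exact₁ X hS x (Subsingleton.elim _ _) rfl
  rw [Subsingleton.elim y 0, Ext.zero_comp]

lemma subsingleton_ext_right (X : A) {i : ℕ} (h₂ : Subsingleton (Ext.{w} X S.X₂ i))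
    (h₁ : Subsingleton (Ext.{w} X S.X₁ (i + 1))) : Subsingleton (Ext.{w} X S.X₃ i) := by
  refine subsingleton_of_forall_eq 0 fun x => ?_
  obtain ⟨y, rfl⟩ := Ext.covariant_sequence_exact₃ X hS x rfl (Subsingleton.elim _ _)
  rw [Subsingleton.elim y 0, Ext.zero_comp]

lemma exists_lift (X : A) (h₁ : Subsingleton (Ext.{w} X S.X₁ 1)) (f : X ⟶ S.X₃) :
    ∃ g : X ⟶ S.X₂, g ≫ S.g = f := by
  obtain ⟨y, hy⟩ := Ext.covariant_sequence_exact₃ X hS (Ext.mk₀ f) (zero_add 1)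
    (Subsingleton.elim _ _)
  obtain ⟨g, rfl⟩ := (Ext.mk₀_bijective _ _).2 y
  rw [Ext.mk₀_comp_mk₀] at hy
  exact ⟨g, (Ext.mk₀_bijective _ _).1 hy⟩

lemma subsingleton_ext_one_of_lift (X : A) (h : ∀ f : X ⟶ S.X₃, ∃ g : X ⟶ S.X₂, g ≫ S.g = f)
    (h₂ : Subsingleton (Ext.{w} X S.X₂ 1)) : Subsingleton (Ext.{w} X S.X₁ 1) := by
  refine subsingleton_of_forall_eq 0 fun x => ?_
  obtain ⟨y, rfl⟩ := Ext.covariant_sequence_exact₁ X hS x (Subsingleton.elim _ _) (zero_add 1)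
  obtain ⟨f, rfl⟩ := (Ext.mk₀_bijective _ _).2 y
  obtain ⟨g, rfl⟩ := h f
  rw [← Ext.mk₀_comp_mk₀, Ext.comp_assoc_of_second_deg_zero, hS.comp_extClass, Ext.comp_zero]

lemma subsingleton_ext_of_left (Y : A) {i : ℕ} (h₃ : Subsingleton (Ext.{w} S.X₃ Y (i + 1)))
    (h₂ : Subsingleton (Ext.{w} S.X₂ Y i)) : Subsingleton (Ext.{w} S.X₁ Y i) := by
  refine subsingleton_of_forall_eq 0 fun x => ?_
  obtain ⟨y, rfl⟩ := Ext.contravariant_sequence_exact₁ hS Y x (add_comm 1 i)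
    (Subsingleton.elim _ _)
  rw [Subsingleton.elim y 0, Ext.comp_zero]

lemma subsingleton_ext_of_right (Y : A) {i : ℕ} (h₁ : Subsingleton (Ext.{w} S.X₁ Y i))
    (h₂ : Subsingleton (Ext.{w} S.X₂ Y (i + 1))) : Subsingleton (Ext.{w} S.X₃ Y (i + 1)) := by
  refine subsingleton_of_forall_eq 0 fun x => ?_
  obtain ⟨y, rfl⟩ := Ext.contravariant_sequence_exact₃ hS Y x (Subsingleton.elim _ _)
    (add_comm 1 i)
  rw [Subsingleton.elim y 0, Ext.comp_zero]

lemma exists_extension (Y : A) (h₃ : Subsingleton (Ext.{w} S.X₃ Y 1)) (f : S.X₁ ⟶ Y) :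
    ∃ g : S.X₂ ⟶ Y, S.f ≫ g = f := by
  obtain ⟨y, hy⟩ := Ext.contravariant_sequence_exact₁ hS Y (Ext.mk₀ f) (add_zero 1)
    (Subsingleton.elim _ _)
  obtain ⟨g, rfl⟩ := (Ext.mk₀_bijective _ _).2 y
  rw [Ext.mk₀_comp_mk₀] at hy
  exact ⟨g, (Ext.mk₀_bijective _ _).1 hy⟩

lemma subsingleton_ext_one_of_extension (Y : A)
    (h : ∀ f : S.X₁ ⟶ Y, ∃ g : S.X₂ ⟶ Y, S.f ≫ g = f)
    (h₂ : Subsingleton (Ext.{w} S.X₂ Y 1)) : Subsingleton (Ext.{w} S.X₃ Y 1) := by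
  refine subsingleton_of_forall_eq 0 fun x => ?_
  obtain ⟨y, rfl⟩ := Ext.contravariant_sequence_exact₃ hS Y x (Subsingleton.elim _ _)
    (add_zero 1)
  obtain ⟨f, rfl⟩ := (Ext.mk₀_bijective _ _).2 y
  obtain ⟨g, rfl⟩ := h f
  rw [← Ext.mk₀_comp_mk₀, ← Ext.comp_assoc_of_second_deg_zero, hS.extClass_comp, Ext.zero_comp]

end CategoryTheory.ShortComplex.ShortExact

/-! ### Characters with values in the circle. -/

/-- The group of additive characters with values in the circle `ℝ ⧸ ℤ`. -/
abbrev CircleDual (A : Type*) [AddCommGroup A] : Type _ := A →+ UnitAddCircle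

namespace CircleDual

variable {A B : Type*} [AddCommGroup A] [AddCommGroup B]

lemma exists_extension (i : A →+ B) (hi : Function.Injective i) (χ : CircleDual A) :
    ∃ ψ : CircleDual B, ψ.comp i = χ := by
  obtain ⟨ψ, hψ⟩ := Module.Baer.extension_property (Module.Baer.of_divisible UnitAddCircle)
    i.toIntLinearMap hi χ.toIntLinearMap
  exact ⟨ψ.toAddMonoidHom, AddMonoidHom.ext fun a => LinearMap.congr_fun hψ a⟩

/-- The inclusion `ℚ ⧸ ℤ → ℝ ⧸ ℤ`. -/
noncomputable def ofRat : AddCircle (1 : ℚ) →+ UnitAddCircle :=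
  QuotientAddGroup.map _ _ (Rat.castHom ℝ).toAddMonoidHom (by
    rw [AddSubgroup.zmultiples_le]
    exact ⟨1, by simp⟩)

lemma ofRat_injective : Function.Injective ofRat := by
  rw [injective_iff_map_eq_zero]
  intro x hx
  obtain ⟨q, rfl⟩ := QuotientAddGroup.mk_surjective x
  have h : ((q : ℝ) : UnitAddCircle) = 0 := hx
  obtain ⟨n, hn⟩ := (AddCircle.coe_eq_zero_iff (1 : ℝ)).1 h
  refine (AddCircle.coe_eq_zero_iff (1 : ℚ)).2 ⟨n, ?_⟩
  have : ((n : ℚ) : ℝ) = (q : ℝ) := by simpa using hn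
  simpa using Rat.cast_injective this

/-- Characters into ℚ/ℤ separate points, and ℚ/ℤ embeds in the circle. The circle is preferred
because it is compact, which the pure-injectivity of double duals uses. -/
lemma exists_apply_ne_zero {a : A} (ha : a ≠ 0) : ∃ χ : CircleDual A, χ a ≠ 0 := by
  obtain ⟨c, hc⟩ := CharacterModule.exists_character_apply_ne_zero_of_ne_zero ha
  exact ⟨ofRat.comp c, fun h => hc (ofRat_injective (h.trans (map_zero ofRat).symm))⟩

lemma exists_vanishing (i : A →+ B) {b : B} (hb : b ∉ i.range) :
    ∃ χ : CircleDual B, χ.comp i = 0 ∧ χ b ≠ 0 := by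
  have hb' : (QuotientAddGroup.mk b : B ⧸ i.range) ≠ 0 := by
    rwa [Ne, QuotientAddGroup.eq_zero_iff]
  obtain ⟨χ, hχ⟩ := exists_apply_ne_zero hb'
  refine ⟨χ.comp (QuotientAddGroup.mk' _), AddMonoidHom.ext fun a => ?_, hχ⟩
  have : (QuotientAddGroup.mk (i a) : B ⧸ i.range) = 0 := by
    rw [QuotientAddGroup.eq_zero_iff]; exact ⟨a, rfl⟩
  simp [this]

/-- A character vanishing on the kernel of `f` factors through `f`. -/
lemma exists_comp_eq_of_ker_le (f : A →+ B) (χ : CircleDual A) (h : ∀ a, f a = 0 → χ a = 0) :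
    ∃ ψ : CircleDual B, ψ.comp f = χ := by
  obtain ⟨ψ, hψ⟩ := exists_extension (QuotientAddGroup.kerLift f)
    (QuotientAddGroup.kerLift_injective f)
    (QuotientAddGroup.lift f.ker χ (fun a ha => h a ha))
  refine ⟨ψ, AddMonoidHom.ext fun a => ?_⟩
  exact DFunLike.congr_fun hψ (QuotientAddGroup.mk a)

end CircleDual

/-! ### The double dual and its commutation with Hom(F, -) for finitely generated F. -/

/-- The double character group of a module. -/
def DoubleDual (L : Type*) [AddCommGroup L] : Type _ := CircleDual (CircleDual L)

namespace DoubleDual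

variable {R : Type*} [Ring R] {L : Type*} [AddCommGroup L] [Module R L]

noncomputable instance : AddCommGroup (DoubleDual L) :=
  inferInstanceAs (AddCommGroup (CircleDual L →+ UnitAddCircle))

instance : FunLike (DoubleDual L) (CircleDual L) UnitAddCircle :=
  inferInstanceAs (FunLike (CircleDual L →+ UnitAddCircle) _ _)

instance : AddMonoidHomClass (DoubleDual L) (CircleDual L) UnitAddCircle :=
  inferInstanceAs (AddMonoidHomClass (CircleDual L →+ UnitAddCircle) _ _)

@[ext] lemma ext {c d : DoubleDual L} (h : ∀ χ, c χ = d χ) : c = d := DFunLike.ext _ _ h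

@[simp] lemma add_apply (c d : DoubleDual L) (χ : CircleDual L) : (c + d) χ = c χ + d χ := rfl

@[simp] lemma zero_apply (χ : CircleDual L) : (0 : DoubleDual L) χ = 0 := rfl

/-- The right action of `R` on the characters of a left `R`-module. -/
def translate (r : R) (χ : CircleDual L) : CircleDual L :=
  χ.comp (DistribSMul.toAddMonoidHom L r)

@[simp] lemma translate_apply (r : R) (χ : CircleDual L) (l : L) :
    translate r χ l = χ (r • l) := rfl

lemma translate_add (r : R) (χ ψ : CircleDual L) :
    translate r (χ + ψ) = translate r χ + translate r ψ := rfl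

noncomputable instance : Module R (DoubleDual L) where
  smul r c := (AddMonoidHom.mk' (fun χ => c (translate r χ))
    (fun χ ψ => by rw [translate_add, map_add]) : CircleDual L →+ UnitAddCircle)
  one_smul c := ext fun χ => congrArg c (by ext; simp)
  mul_smul r s c := ext fun χ => congrArg c (by ext; simp [mul_smul])
  smul_zero r := rfl
  smul_add r c d := rfl
  add_smul r s c := ext fun χ => by
    change c _ = c _ + c _
    rw [← map_add]
    exact congrArg c (by ext; simp [add_smul])
  zero_smul c := ext fun χ => by
    change c _ = 0
    rw [← map_zero c]
    exact congrArg c (by ext; simp)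

@[simp] lemma smul_apply (r : R) (c : DoubleDual L) (χ : CircleDual L) :
    (r • c) χ = c (translate r χ) := rfl

variable (R L) in
/-- The evaluation map from a module to its double dual. -/
noncomputable def eval : L →ₗ[R] DoubleDual L where
  toFun l := (AddMonoidHom.eval l : CircleDual L →+ UnitAddCircle)
  map_add' x y := ext fun χ => map_add χ x y
  map_smul' _ _ := rfl

section Comparison

variable {F : Type*} [AddCommGroup F] [Module R F]

/-- Evaluation of linear maps at an element. -/
def evalHom (L : Type*) [AddCommGroup L] [Module R L] (x : F) : (F →ₗ[R] L) →+ L where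
  toFun g := g x
  map_zero' := rfl
  map_add' _ _ := rfl

@[simp] lemma evalHom_apply (x : F) (g : F →ₗ[R] L) : evalHom L x g = g x := rfl

/-- The comparison map `Hom(F, L)^{++} → Hom(F, L^{++})`. -/
noncomputable def comparison (Φ : DoubleDual (F →ₗ[R] L)) : F →ₗ[R] DoubleDual L where
  toFun x := (AddMonoidHom.mk' (fun χ => Φ (χ.comp (evalHom L x)))
    (fun χ ψ => by rw [AddMonoidHom.add_comp, map_add]) : CircleDual L →+ UnitAddCircle)
  map_add' x y := ext fun χ => by
    change Φ _ = Φ _ + Φ _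
    rw [← map_add]
    exact congrArg Φ (by ext; simp)
  map_smul' r x := ext fun χ => congrArg Φ (by ext; simp)

variable {ι : Type*}

/-- Evaluation of linear maps at a finite family of elements. -/
def evalFamily (L : Type*) [AddCommGroup L] [Module R L] (x : ι → F) :
    (F →ₗ[R] L) →+ (ι → L) where
  toFun g i := g (x i)
  map_zero' := rfl
  map_add' _ _ := rfl

open Classical in
lemma comp_evalFamily [Fintype ι] (x : ι → F) (χ : CircleDual (ι → L)) :
    χ.comp (evalFamily (R := R) L x) =
      ∑ i, (χ.comp (AddMonoidHom.single (fun _ => L) i)).comp (evalHom (R := R) L (x i)) := by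
  ext g
  simp only [AddMonoidHom.comp_apply, AddMonoidHom.finsetSum_apply, ← map_sum]
  congr 1
  exact (Finset.univ_sum_single (evalFamily L x g)).symm

lemma evalFamily_injective {x : ι → F} (hx : Submodule.span R (Set.range x) = ⊤) :
    Function.Injective (evalFamily (R := R) L x) := by
  intro g g' h
  refine LinearMap.ext_on_range hx fun i => congrFun h i

variable [Module.Finite R F]

/-- Finitely many generators of F embed Hom(F, L) in L^m, so each character of Hom(F, L) extends to
L^m and is a sum of characters of the form χ ∘ (evaluation at a generator). The comparison map
records the values on exactly these. -/
lemma comparison_injective : Function.Injective (comparison (R := R) (F := F) (L := L)) := by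
  classical
  obtain ⟨m, x, hx⟩ := Module.Finite.exists_fin (R := R) (M := F)
  intro Φ Ψ h
  refine ext fun ξ => ?_
  obtain ⟨χ, rfl⟩ := CircleDual.exists_extension _ (evalFamily_injective (L := L) hx) ξ
  rw [comp_evalFamily, map_sum, map_sum]
  exact Finset.sum_congr rfl fun i _ => DFunLike.congr_fun (LinearMap.congr_fun h (x i)) _

lemma comparison_surjective [IsNoetherianRing R] :
    Function.Surjective (comparison (R := R) (F := F) (L := L)) := by
  classical
  intro c
  obtain ⟨m, x, hx⟩ := Module.Finite.exists_fin (R := R) (M := F)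
  let p : (Fin m → R) →ₗ[R] F := Fintype.linearCombination R x
  have hp : Function.Surjective p := by
    rw [← LinearMap.range_eq_top, Fintype.range_linearCombination, hx]
  obtain ⟨k, s, hs⟩ := Module.Finite.exists_fin (R := R) (M := LinearMap.ker p)
  -- the system of equations defining `Hom(F, L)` inside `L ^ m`
  let ρ : (Fin m → L) →+ (Fin k → L) :=
    { toFun := fun l i => ∑ j, (s i : Fin m → R) j • l j
      map_zero' := by ext; simp
      map_add' := fun l l' => by ext; simp [Finset.sum_add_distrib] }
  have hρ (l : Fin m → L) (hl : ρ l = 0) : ∃ g : F →ₗ[R] L, evalFamily L x g = l := by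
    have hker : LinearMap.ker p ≤ LinearMap.ker (Fintype.linearCombination R l) := by
      intro y hy
      have h0 : (Fintype.linearCombination R l).comp (LinearMap.ker p).subtype = 0 :=
        LinearMap.ext_on_range hs fun i => congrFun hl i
      exact LinearMap.congr_fun h0 ⟨y, hy⟩
    refine ⟨((LinearMap.ker p).liftQ _ hker).comp
      (p.quotKerEquivOfSurjective hp).symm.toLinearMap, funext fun i => ?_⟩
    have hi : x i = p (Pi.single i 1) := by simp [p]
    have : (p.quotKerEquivOfSurjective hp).symm (x i) =
        Submodule.Quotient.mk (Pi.single i (1 : R)) := by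
      rw [LinearEquiv.symm_apply_eq, hi]
      rfl
    change (LinearMap.ker p).liftQ _ hker ((p.quotKerEquivOfSurjective hp).symm (x i)) = l i
    rw [this]
    simp
  let q : CircleDual (Fin m → L) →+ CircleDual (F →ₗ[R] L) :=
    AddMonoidHom.mk' (fun χ => χ.comp (evalFamily L x)) fun _ _ => AddMonoidHom.add_comp _ _ _
  have hq : Function.Surjective q :=
    CircleDual.exists_extension _ (evalFamily_injective (L := L) hx)
  -- The values that c forces on characters of L^m; it remains to descend κ along the surjection q.
  let κ : CircleDual (Fin m → L) →+ UnitAddCircle :=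
    AddMonoidHom.mk' (fun χ => ∑ i, c (x i) (χ.comp (AddMonoidHom.single (fun _ => L) i)))
      fun χ ψ => by simp only [AddMonoidHom.add_comp, map_add, Finset.sum_add_distrib]
  -- A character killed by q vanishes on Hom(F, L), the kernel of ρ, hence equals ζ ∘ ρ. Then κ
  -- evaluates c on the relations among the generators, which are zero in F.
  have hκ : q.ker ≤ κ.ker := by
    intro χ hχ
    obtain ⟨ζ, rfl⟩ := CircleDual.exists_comp_eq_of_ker_le ρ χ fun l hl => by
      obtain ⟨g, rfl⟩ := hρ l hl
      exact DFunLike.congr_fun hχ g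
    have hsum (j : Fin m) : (ζ.comp ρ).comp (AddMonoidHom.single (fun _ => L) j) =
        ∑ i, translate ((s i : Fin m → R) j)
          (ζ.comp (AddMonoidHom.single (fun _ : Fin k => L) i)) := by
      ext l
      simp only [AddMonoidHom.comp_apply, AddMonoidHom.finsetSum_apply, translate_apply,
        ← map_sum]
      congr 1
      ext i
      simp [ρ, Pi.single_apply, Finset.sum_apply]
    change ∑ j, c (x j) _ = 0
    simp_rw [hsum, map_sum, ← smul_apply, ← map_smul]
    rw [Finset.sum_comm]
    refine Finset.sum_eq_zero fun i _ => ?_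
    have hs0 : ∑ j, (s i : Fin m → R) j • x j = 0 := (s i).2
    have hsum_apply (f : Fin m → DoubleDual L) (χ : CircleDual L) :
        ∑ j, f j χ = (∑ j, f j) χ :=
      (map_sum (AddMonoidHom.eval χ : (CircleDual L →+ UnitAddCircle) →+ _) f _).symm
    rw [hsum_apply, ← map_sum, hs0, map_zero, zero_apply]
  let Φ : CircleDual (F →ₗ[R] L) →+ UnitAddCircle := q.liftOfSurjective hq ⟨κ, hκ⟩
  have hΦ (χ) : Φ (q χ) = κ χ := q.liftOfRightInverse_comp_apply _ _ ⟨κ, hκ⟩ χ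
  refine ⟨Φ, LinearMap.ext_on_range hx fun i => ext fun χ => ?_⟩
  let χ' : CircleDual (Fin m → L) := χ.comp (Pi.evalAddMonoidHom _ i)
  have h₁ : q χ' = χ.comp (evalHom L (x i)) := rfl
  change Φ (χ.comp (evalHom L (x i))) = _
  rw [← h₁, hΦ]
  change ∑ j, c (x j) _ = _
  rw [Finset.sum_eq_single i]
  · congr 1
    ext l
    simp [χ']
  · intro j _ hj
    convert map_zero (c (x j))
    ext l
    simp [χ', hj]
  · simp

end Comparison

end DoubleDual

/-! ### Pure monomorphisms and pure-injectivity of double duals. -/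

section Purity

variable {R : Type u} [Ring R] {A B C : Type u} [AddCommGroup A] [AddCommGroup B] [AddCommGroup C]
  [Module R A] [Module R B] [Module R C]

/-- A linear map is a pure monomorphism if every finite system of linear equations with constants
in the source which is solvable in the target is solvable in the source. -/
def IsPureMono (i : A →ₗ[R] B) : Prop :=
  ∀ ⦃F G : ModuleCat.{u} R⦄, Module.Finite R F → Module.Finite R G →
    ∀ (r : F →ₗ[R] G) (a : F →ₗ[R] A) (b : G →ₗ[R] B), b ∘ₗ r = i ∘ₗ a →
      ∃ k : G →ₗ[R] A, k ∘ₗ r = a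

variable {i : A →ₗ[R] B} {p : B →ₗ[R] C}

/-- The map b induces G / r(F) → C; subtracting from b a lift of it to B leaves a map with image in
A. -/
lemma isPureMono_of_lift (hi : Function.Injective i) (hip : Function.Exact i p)
    (h : ∀ (Q : ModuleCat.{u} R), Module.Finite R Q → ∀ f : Q →ₗ[R] C,
      ∃ g : Q →ₗ[R] B, p ∘ₗ g = f) : IsPureMono i := by
  intro F G _ _ r a b hab
  have hle : LinearMap.range r ≤ LinearMap.ker (p ∘ₗ b) := by
    rintro _ ⟨x, rfl⟩
    have := LinearMap.congr_fun hab x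
    simp only [LinearMap.comp_apply] at this
    simp [this, hip.apply_apply_eq_zero]
  obtain ⟨g, hg⟩ := h (ModuleCat.of R (G ⧸ LinearMap.range r))
    (inferInstanceAs (Module.Finite R (G ⧸ LinearMap.range r))) ((LinearMap.range r).liftQ _ hle)
  let d : G →ₗ[R] B := b - g ∘ₗ (LinearMap.range r).mkQ
  have hd (y : G) : d y ∈ LinearMap.range i := by
    refine (hip (d y)).1 ?_
    have := LinearMap.congr_fun hg (Submodule.Quotient.mk y)
    simp only [LinearMap.comp_apply, Submodule.liftQ_apply] at this
    simp [d, this]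
  let e := LinearEquiv.ofInjective i hi
  refine ⟨e.symm.toLinearMap ∘ₗ d.codRestrict _ hd, LinearMap.ext fun x => ?_⟩
  refine e.symm_apply_eq.2 (Subtype.ext ?_)
  have h₁ : (Submodule.Quotient.mk (r x) : G ⧸ LinearMap.range r) = 0 :=
    (Submodule.Quotient.mk_eq_zero _).2 ⟨x, rfl⟩
  have := LinearMap.congr_fun hab x
  simpa [d, e, h₁] using this

namespace IsPureMono

variable (hpure : IsPureMono i)

include hpure

lemma injective : Function.Injective i := by
  rw [injective_iff_map_eq_zero]
  intro a ha
  obtain ⟨k, hk⟩ := hpure (F := ModuleCat.of R R) (G := ModuleCat.of R PUnit.{u + 1})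
    (inferInstanceAs (Module.Finite R R)) (inferInstanceAs (Module.Finite R PUnit.{u + 1})) 0
    (LinearMap.toSpanSingleton R A a) 0 (LinearMap.ext fun r => by simp [ha])
  simpa using (LinearMap.congr_fun hk (1 : R)).symm

lemma exists_lift [IsNoetherianRing R] (hip : Function.Exact i p) (hp : Function.Surjective p)
    {Q : Type u} [AddCommGroup Q] [Module R Q] [Module.Finite R Q] (f : Q →ₗ[R] C) :
    ∃ g : Q →ₗ[R] B, p ∘ₗ g = f := by
  obtain ⟨m, q, hq⟩ := Module.Finite.exists_fin' R Q
  obtain ⟨b, hb⟩ := Module.projective_lifting_property p (f ∘ₗ q) hp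
  let e := LinearEquiv.ofInjective i hpure.injective
  have hb' (x : LinearMap.ker q) : b x ∈ LinearMap.range i := by
    refine (hip (b x)).1 ?_
    have := LinearMap.congr_fun hb x
    simp only [LinearMap.comp_apply] at this
    rw [this, x.2, map_zero]
  let a : LinearMap.ker q →ₗ[R] A :=
    e.symm.toLinearMap ∘ₗ (b ∘ₗ (LinearMap.ker q).subtype).codRestrict _ hb'
  have hia : i ∘ₗ a = b ∘ₗ (LinearMap.ker q).subtype := LinearMap.ext fun x =>
    congrArg Subtype.val (e.apply_symm_apply ⟨b x, hb' x⟩)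
  -- Purity is applied to the relations of Q, finitely generated since R is noetherian; b - i ∘ k
  -- then kills them and descends to Q.
  obtain ⟨k, hk⟩ := hpure (F := ModuleCat.of R (LinearMap.ker q))
    (G := ModuleCat.of R (Fin m → R)) (inferInstanceAs (Module.Finite R (LinearMap.ker q)))
    (inferInstanceAs (Module.Finite R (Fin m → R))) (LinearMap.ker q).subtype a b hia.symm
  have hker : LinearMap.ker q ≤ LinearMap.ker (b - i ∘ₗ k) := fun x hx => by
    have h₁ := LinearMap.congr_fun hk ⟨x, hx⟩
    have h₂ := LinearMap.congr_fun hia ⟨x, hx⟩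
    simp only [LinearMap.comp_apply, Submodule.subtype_apply] at h₁ h₂
    simp [← h₂, ← h₁]
  refine ⟨(LinearMap.ker q).liftQ _ hker ∘ₗ (q.quotKerEquivOfSurjective hq).symm.toLinearMap,
    LinearMap.ext fun y => ?_⟩
  obtain ⟨x, rfl⟩ := hq y
  have : (q.quotKerEquivOfSurjective hq).symm (q x) = Submodule.Quotient.mk x := by
    rw [LinearEquiv.symm_apply_eq]; rfl
  have hbx := LinearMap.congr_fun hb x
  simp only [LinearMap.comp_apply] at hbx
  simp only [LinearMap.comp_apply, LinearEquiv.coe_coe, this, Submodule.liftQ_apply,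
    LinearMap.sub_apply, map_sub, hip.apply_apply_eq_zero, sub_zero, hbx]

/-- Double duals are pure-injective. -/
lemma exists_extension_doubleDual [IsNoetherianRing R] {L : Type u} [AddCommGroup L] [Module R L]
    (c : A →ₗ[R] DoubleDual L) : ∃ h : B →ₗ[R] DoubleDual L, h ∘ₗ i = c := by
  classical
  -- The functions that restrict on S to a linear map into the double dual agreeing with c. These
  -- are closed in a product of circles, compact by Tychonoff, so local solutions on all finitely
  -- generated S give a global one.
  let Z (S : {S : Submodule R B // S.FG}) : Set (B → CircleDual L → UnitAddCircle) :=
    {h | (∀ b ∈ S.1, ∀ b' ∈ S.1, ∀ χ, h (b + b') χ = h b χ + h b' χ) ∧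
      (∀ (r : R), ∀ b ∈ S.1, ∀ χ, h (r • b) χ = h b (DoubleDual.translate r χ)) ∧
      (∀ b ∈ S.1, ∀ χ ψ, h b (χ + ψ) = h b χ + h b ψ) ∧
      (∀ a, i a ∈ S.1 → ∀ χ, h (i a) χ = c a χ)}
  have hanti {S T : {S : Submodule R B // S.FG}} (hST : S.1 ≤ T.1) : Z T ⊆ Z S :=
    fun h hh => ⟨fun b hb b' hb' => hh.1 b (hST hb) b' (hST hb'),
      fun r b hb => hh.2.1 r b (hST hb), fun b hb => hh.2.2.1 b (hST hb),
      fun a ha => hh.2.2.2 a (hST ha)⟩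
  have hdir : Directed (· ⊇ ·) Z := fun S T =>
    ⟨⟨S.1 ⊔ T.1, S.2.sup T.2⟩, hanti le_sup_left, hanti le_sup_right⟩
  have hne (S) : (Z S).Nonempty := by
    have : Module.Finite R S.1 := Module.Finite.iff_fg.2 S.2
    let N := S.1.comap i
    have hN : Module.Finite R N := Module.Finite.of_injective
      (i.restrict (p := N) (q := S.1) fun _ h => h)
      fun x y hxy => Subtype.ext (hpure.injective (congrArg Subtype.val hxy))
    -- Here k : S → A is the identity on S ∩ A, so c ∘ k is a solution on S.
    obtain ⟨k, hk⟩ := hpure (F := ModuleCat.of R N) (G := ModuleCat.of R S.1) hN this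
      (i.restrict (p := N) (q := S.1) fun _ h => h) N.subtype S.1.subtype rfl
    refine ⟨fun b χ => if hb : b ∈ S.1 then c (k ⟨b, hb⟩) χ else 0, ?_, ?_, ?_, ?_⟩
    · intro b hb b' hb' χ
      simp only [hb, hb', add_mem hb hb', dite_true]
      rw [← DoubleDual.add_apply, ← map_add, ← map_add]
      rfl
    · intro r b hb χ
      simp only [hb, S.1.smul_mem r hb, dite_true]
      rw [← DoubleDual.smul_apply, ← map_smul, ← map_smul]
      rfl
    · intro b hb χ ψ
      simp only [hb, dite_true, map_add]
    · intro a ha χ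
      simp only [ha, dite_true]
      have := LinearMap.congr_fun hk (⟨a, ha⟩ : N)
      exact congrArg (fun a => c a χ) this
  have hcl (S) : IsClosed (Z S) := by
    have happ (b : B) (χ : CircleDual L) :
        Continuous fun h : B → CircleDual L → UnitAddCircle => h b χ :=
      (continuous_apply χ).comp (continuous_apply b)
    simp only [Z, Set.ofPred_and, Set.ofPred_forall]
    refine IsClosed.inter ?_ (IsClosed.inter ?_ (IsClosed.inter ?_ ?_))
    · exact isClosed_iInter fun _ => isClosed_iInter fun _ => isClosed_iInter fun _ =>
        isClosed_iInter fun _ => isClosed_iInter fun _ =>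
          isClosed_eq (happ _ _) ((happ _ _).add (happ _ _))
    · exact isClosed_iInter fun _ => isClosed_iInter fun _ => isClosed_iInter fun _ =>
        isClosed_iInter fun _ => isClosed_eq (happ _ _) (happ _ _)
    · exact isClosed_iInter fun _ => isClosed_iInter fun _ => isClosed_iInter fun _ =>
        isClosed_iInter fun _ => isClosed_eq (happ _ _) ((happ _ _).add (happ _ _))
    · exact isClosed_iInter fun _ => isClosed_iInter fun _ => isClosed_iInter fun _ =>
        isClosed_eq (happ _ _) continuous_const
  have : Nonempty {S : Submodule R B // S.FG} := ⟨⟨⊥, Submodule.fg_bot⟩⟩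
  obtain ⟨h, hh⟩ := IsCompact.nonempty_iInter_of_directed_nonempty_isCompact_isClosed Z hdir hne
    (fun S => (hcl S).isCompact) hcl
  have hh (S : Submodule R B) (hS : S.FG) : h ∈ Z ⟨S, hS⟩ := Set.mem_iInter.1 hh ⟨S, hS⟩
  have hspan (b : B) : h ∈ Z ⟨R ∙ b, Submodule.fg_span_singleton b⟩ := hh _ _
  refine ⟨{ toFun := fun b => (AddMonoidHom.mk' (h b) ((hspan b).2.2.1 b
                (Submodule.mem_span_singleton_self b)) : CircleDual L →+ UnitAddCircle)
            map_add' := fun b b' => DoubleDual.ext fun χ =>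
              (hh _ ((Submodule.fg_span_singleton b).sup (Submodule.fg_span_singleton b'))).1 b
                (Submodule.mem_sup_left (Submodule.mem_span_singleton_self b)) b'
                (Submodule.mem_sup_right (Submodule.mem_span_singleton_self b')) χ
            map_smul' := fun r b => DoubleDual.ext fun χ =>
              (hspan b).2.1 r b (Submodule.mem_span_singleton_self b) χ },
    LinearMap.ext fun a => DoubleDual.ext fun χ => ?_⟩
  exact (hspan (i a)).2.2.2 a (Submodule.mem_span_singleton_self _) χ

end IsPureMono

namespace DoubleDual

variable [IsNoetherianRing R] {L : Type u} [AddCommGroup L] [Module R L]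

variable (R L) in
-- If a did not extend along r, a character ξ of Hom(F, L) would vanish on the restrictions from G
-- but not on a. Writing b as the comparison image of Φ, injectivity of the comparison map gives
-- ξ(a) = Φ(ξ ∘ res) = 0.
lemma isPureMono_eval : IsPureMono (eval R L) := by
  intro F G _ _ r a b hab
  let res : (G →ₗ[R] L) →+ (F →ₗ[R] L) :=
    AddMonoidHom.mk' (fun k => k ∘ₗ r) fun _ _ => LinearMap.add_comp _ _ _
  by_contra! hno
  obtain ⟨ξ, hξ, hξa⟩ := CircleDual.exists_vanishing res (b := a) fun ⟨k, hk⟩ => hno k hk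
  obtain ⟨Φ, rfl⟩ := comparison_surjective b
  let resD : DoubleDual (F →ₗ[R] L) := (AddMonoidHom.mk' (fun ξ => Φ (ξ.comp res))
    (fun _ _ => by rw [AddMonoidHom.add_comp, map_add]) : CircleDual (F →ₗ[R] L) →+ UnitAddCircle)
  have key : resD = eval ℤ (F →ₗ[R] L) a := by
    refine comparison_injective (R := R) (LinearMap.ext fun x => DoubleDual.ext fun χ => ?_)
    exact DFunLike.congr_fun (LinearMap.congr_fun hab x) χ
  refine hξa ?_
  have h₁ : resD ξ = ξ a := DFunLike.congr_fun key ξ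
  have h₂ : resD ξ = Φ (ξ.comp res) := rfl
  rw [← h₁, h₂, hξ, map_zero]

/-- Surjectivity of Hom(r, L) makes its dual injective, so functionals extend along that dual. -/
lemma exists_extension {F G : Type u} [AddCommGroup F] [Module R F] [Module.Finite R F]
    [AddCommGroup G] [Module R G] (r : F →ₗ[R] G)
    (h : ∀ a : F →ₗ[R] L, ∃ b : G →ₗ[R] L, b ∘ₗ r = a) (c : F →ₗ[R] DoubleDual L) :
    ∃ d : G →ₗ[R] DoubleDual L, d ∘ₗ r = c := by
  obtain ⟨Φ, rfl⟩ := comparison_surjective c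
  let res : (G →ₗ[R] L) →+ (F →ₗ[R] L) :=
    AddMonoidHom.mk' (fun k => k ∘ₗ r) fun _ _ => LinearMap.add_comp _ _ _
  let resD : CircleDual (F →ₗ[R] L) →+ CircleDual (G →ₗ[R] L) :=
    AddMonoidHom.mk' (fun ξ => ξ.comp res) fun _ _ => AddMonoidHom.add_comp _ _ _
  obtain ⟨Ψ, hΨ⟩ := CircleDual.exists_extension resD (fun ξ ξ' hξ => AddMonoidHom.ext fun a => by
    obtain ⟨b, rfl⟩ := h a
    exact DFunLike.congr_fun hξ b) Φ
  exact ⟨comparison Ψ, LinearMap.ext fun x => DoubleDual.ext fun χ =>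
    DFunLike.congr_fun hΨ (χ.comp (evalHom L x))⟩

end DoubleDual

end Purity

/-! ### Finitely presentable objects are the finitely generated modules. -/

namespace ModuleCat

variable (R : Type u) [Ring R]

attribute [local instance] Cardinal.fact_isRegular_aleph0

/-- Morphisms out of the regular module are elements. -/
def coyonedaSelfIso : coyoneda.obj (Opposite.op (ModuleCat.of R R)) ≅ forget (ModuleCat.{u} R) :=
  NatIso.ofComponents (fun X => Equiv.toIso
    (ModuleCat.homEquiv.trans (LinearMap.ringLmapEquivSelf R ℕ X).toEquiv)) (by
      intro X Y f
      ext g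
      rfl)

instance isFinitelyPresentable_self : IsFinitelyPresentable.{u} (ModuleCat.of R R) := by
  rw [isFinitelyPresentable_iff_preservesFilteredColimits]
  have := ModuleCat.FilteredColimits.forget_preservesFilteredColimits.{u} (R := R)
  refine ⟨fun J _ _ => ?_⟩
  exact preservesColimitsOfShape_of_natIso (coyonedaSelfIso R).symm

lemma isStrongGenerator_self :
    (ObjectProperty.singleton (ModuleCat.of R R)).IsStrongGenerator := by
  rw [ObjectProperty.isStrongGenerator_iff]
  have key {X Y : ModuleCat.{u} R} (f g : X ⟶ Y)
    (h : ∀ k : ModuleCat.of R R ⟶ X, k ≫ f = k ≫ g) : f = g := by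
    ext x
    simpa using ConcreteCategory.congr_hom
      (h (ModuleCat.ofHom (LinearMap.toSpanSingleton R X x))) (1 : R)
  refine ⟨fun X Y f g h => key f g fun k => h _ (by simp) k, fun X Y i _ h => ?_⟩
  have : Epi i := by
    rw [ModuleCat.epi_iff_surjective]
    intro y
    obtain ⟨k, hk⟩ := h (ModuleCat.of R R) (by simp)
      (ModuleCat.ofHom (LinearMap.toSpanSingleton R Y y))
    refine ⟨k (1 : R), ?_⟩
    simpa using ConcreteCategory.congr_hom hk (1 : R)
  exact isIso_of_mono_of_epi i

lemma singleton_self_le :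
    ObjectProperty.singleton (ModuleCat.of R R) ≤ isCardinalPresentable.{u} (ModuleCat.{u} R)
      Cardinal.aleph0.{u} := by
  rw [ObjectProperty.singleton_le_iff]
  exact isFinitelyPresentable_self R

instance isLocallyFinitelyPresentable :
    IsCardinalLocallyPresentable (ModuleCat.{u} R) Cardinal.aleph0.{u} := by
  rw [IsCardinalLocallyPresentable.iff_exists_isStrongGenerator]
  exact ⟨_, inferInstance, isStrongGenerator_self R, singleton_self_le R⟩

lemma isFinitelyPresentable_of_finite [IsNoetherianRing R] (F : ModuleCat.{u} R)
    [Module.Finite R F] : IsFinitelyPresentable.{u} F := by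
  have hlt (J : Type) [SmallCategory J] [FinCategory J] :
      HasCardinalLT (Arrow J) Cardinal.aleph0.{u} := by
    rw [hasCardinalLT_aleph0_iff]; infer_instance
  have hfree (m : ℕ) : IsFinitelyPresentable.{u} (ModuleCat.of R (Fin m → R)) := by
    let e : (⨁ fun _ : Fin m => ModuleCat.of R R) ≅ ModuleCat.of R (Fin m → R) :=
      ModuleCat.biproductIsoPi _
    have (k : Discrete (Fin m)) : IsCardinalPresentable.{u}
        ((Discrete.functor fun _ : Fin m => ModuleCat.of R R).obj k) Cardinal.aleph0.{u} :=
      isFinitelyPresentable_self R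
    have : IsCardinalPresentable.{u} (⨁ fun _ : Fin m => ModuleCat.of R R) Cardinal.aleph0.{u} :=
      isCardinalPresentable_of_isColimit _ (biproduct.isColimit fun _ : Fin m =>
      ModuleCat.of R R) Cardinal.aleph0.{u} (hlt _)
    exact isCardinalPresentable_of_iso e _
  obtain ⟨m, q, hq⟩ := Module.Finite.exists_fin' R F
  obtain ⟨k, q', hq'⟩ := Module.Finite.exists_fin' R (LinearMap.ker q)
  let S : ShortComplex (ModuleCat.{u} R) := ModuleCat.shortComplexOfCompEqZero
    ((LinearMap.ker q).subtype ∘ₗ q') q (by ext; simp)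
  have hS : S.Exact := ModuleCat.shortComplex_exact S (by
    intro x
    constructor
    · intro hx
      obtain ⟨y, hy⟩ := hq' ⟨x, hx⟩
      exact ⟨y, congrArg Subtype.val hy⟩
    · rintro ⟨y, rfl⟩
      exact (q' y).2)
  have : Epi S.g := (ModuleCat.epi_iff_surjective _).2 hq
  have (j : WalkingParallelPair) : IsCardinalPresentable.{u} ((parallelPair S.f 0).obj j)
      Cardinal.aleph0.{u} := by
    cases j
    · exact hfree k
    · exact hfree m
  exact isCardinalPresentable_of_isColimit _ hS.gIsCokernel Cardinal.aleph0.{u} (hlt _)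

/-- Finitely presentable modules form the closure of the regular module under finite colimits, and a
colimit is generated by the images of its legs. -/
lemma finite_of_isFinitelyPresentable (F : ModuleCat.{u} R) [hF : IsFinitelyPresentable.{u} F] :
    Module.Finite R F := by
  have h₁ := IsStrongGenerator.colimitsCardinalClosure_eq_isCardinalPresentable
    (isStrongGenerator_self R) (singleton_self_le R)
  have h₂ : (isCardinalPresentable.{u} (ModuleCat.{u} R) Cardinal.aleph0.{u}) F := hF
  rw [h₁] at h₂
  have hiso : (ModuleCat.isFG R).IsClosedUnderIsomorphisms :=
    ⟨fun e (h : Module.Finite R _) => Module.Finite.equiv e.toLinearEquiv⟩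
  refine ObjectProperty.colimitsCardinalClosure_le (Q := ModuleCat.isFG R) _ Cardinal.aleph0
    (fun J _ hJ => ⟨?_⟩) ?_ F h₂
  · rintro X ⟨hX⟩
    have : Finite J := by
      rw [← hasCardinalLT_aleph0_iff.{u}]
      exact hasCardinalLT_of_hasCardinalLT_arrow hJ
    let N : Submodule R X := ⨆ j, LinearMap.range (hX.ι.app j).hom
    have hN : N.FG := Submodule.fg_iSup _ fun j => by
      have : Module.Finite R (hX.diag.obj j) := hX.prop_diag_obj j
      rw [LinearMap.range_eq_map]
      exact Module.Finite.fg_top.map _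
    have h0 : ModuleCat.ofHom N.mkQ = ModuleCat.ofHom 0 := hX.isColimit.hom_ext fun j => by
      apply ModuleCat.hom_ext
      refine LinearMap.ext fun x => ?_
      exact (Submodule.Quotient.mk_eq_zero N).2 (Submodule.mem_iSup_of_mem j
        (LinearMap.mem_range_self (hX.ι.app j).hom x))
    have h1 : N.mkQ = 0 := congrArg ModuleCat.Hom.hom h0
    have h2 : N = ⊤ := by rw [← N.ker_mkQ, h1, LinearMap.ker_zero]
    exact ⟨h2 ▸ hN⟩
  · rw [ObjectProperty.singleton_le_iff]
    exact inferInstanceAs (Module.Finite R R)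

end ModuleCat

/-! ### The factorization criterion for filtered colimits. -/

section LimClosure

variable {Λ : Type u} [Ring Λ] [IsNoetherianRing Λ] {M : ObjectProperty (FGModuleCat.{u} Λ)}

attribute [local instance] Cardinal.fact_isRegular_aleph0 in
lemma limClosure_iff_factors {X : ModuleCat.{u} Λ} :
    limClosure M X ↔ ∀ (F : FGModuleCat.{u} Λ) (f : F.obj ⟶ X),
      ∃ (N : FGModuleCat.{u} Λ) (g : F.obj ⟶ N.obj) (h : N.obj ⟶ X), M N ∧ g ≫ h = f := by
  have : IsFinitelyAccessibleCategory.{u} (ModuleCat.{u} Λ) := inferInstanceAs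
    (IsCardinalAccessibleCategory (ModuleCat.{u} Λ) Cardinal.aleph0.{u})
  have hle : inMod M ≤ ObjectProperty.isFinitelyPresentable.{u} (ModuleCat.{u} Λ) := by
    rintro X hX
    obtain ⟨Y, _, ⟨e⟩⟩ := (M.prop_map_iff _ X).1 hX
    have : IsFinitelyPresentable.{u} ((ModuleCat.isFG Λ).ι.obj Y) :=
      ModuleCat.isFinitelyPresentable_of_finite Λ Y.obj
    exact isCardinalPresentable_of_iso e _
  rw [limClosure, ObjectProperty.ind_iff_exists hle]
  constructor
  · intro h F f
    have := ModuleCat.isFinitelyPresentable_of_finite Λ F.obj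
    obtain ⟨W, u, v, huv, hW⟩ := h f
    obtain ⟨N, hN, ⟨e⟩⟩ := (M.prop_map_iff _ W).1 hW
    exact ⟨N, u ≫ e.inv, e.hom ≫ v, hN, by simpa using huv⟩
  · intro h Z f _
    obtain ⟨N, g, k, hN, hk⟩ := h ⟨Z, ModuleCat.finite_of_isFinitelyPresentable Λ Z⟩ f
    exact ⟨N.obj, g, k, hk, M.prop_map_obj _ hN⟩

end LimClosure

/-! ### Ext against M, cosyzygies and part (d). -/

section

variable {Λ : Type u} [Ring Λ]

/-- The morphism `f` factors through an object of `M`. -/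
def FactorsThrough (M : ObjectProperty (FGModuleCat.{u} Λ)) {F X : ModuleCat.{u} Λ}
    (f : F ⟶ X) : Prop :=
  ∃ (N : FGModuleCat.{u} Λ) (g : F ⟶ N.obj) (h : N.obj ⟶ X), M N ∧ g ≫ h = f

lemma FactorsThrough.postcomp {M : ObjectProperty (FGModuleCat.{u} Λ)} {F X Y : ModuleCat.{u} Λ}
    {f : F ⟶ X} (hf : FactorsThrough M f) (e : X ⟶ Y) : FactorsThrough M (f ≫ e) := by
  obtain ⟨N, g, h, hN, rfl⟩ := hf
  exact ⟨N, g, h ≫ e, hN, by simp⟩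

variable [IsNoetherianRing Λ]

namespace FGModuleCat

lemma shortExact_of_map {S : ShortComplex (FGModuleCat.{u} Λ)}
    (hS : (S.map (forget₂ (FGModuleCat.{u} Λ) (ModuleCat.{u} Λ))).ShortExact) : S.ShortExact where
  exact := (S.exact_map_iff_of_faithful (forget₂ (FGModuleCat.{u} Λ) (ModuleCat.{u} Λ))).1 hS.exact
  mono_f := (forget₂ (FGModuleCat.{u} Λ) (ModuleCat.{u} Λ)).mono_of_mono_map hS.mono_f
  epi_g := (forget₂ (FGModuleCat.{u} Λ) (ModuleCat.{u} Λ)).epi_of_epi_map hS.epi_g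

lemma exists_shortExact_free (X : FGModuleCat.{u} Λ) :
    ∃ (S : ShortComplex (FGModuleCat.{u} Λ)), S.ShortExact ∧ S.X₃ = X ∧
      ∃ m, S.X₂ = FGModuleCat.of Λ (Fin m → Λ) := by
  obtain ⟨m, q, hq⟩ := Module.Finite.exists_fin' Λ X
  let S : ShortComplex (FGModuleCat.{u} Λ) :=
    { X₁ := FGModuleCat.of Λ (LinearMap.ker q)
      X₂ := FGModuleCat.of Λ (Fin m → Λ)
      X₃ := X
      f := ObjectProperty.homMk (ModuleCat.ofHom (LinearMap.ker q).subtype)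
      g := ObjectProperty.homMk (ModuleCat.ofHom q)
      zero := by ext x; exact x.2 }
  exact ⟨S, shortExact_of_map (LinearMap.shortExact_shortComplexKer hq), rfl, m, rfl⟩

end FGModuleCat

/-- Vanishing of `Ext` in `Λ`-mod against a class of finitely generated modules implies vanishing
in `Λ`-Mod against modules all of whose finitely generated pieces factor through that class. -/
lemma subsingleton_ext_of_factorsThrough (P : ObjectProperty (FGModuleCat.{u} Λ))
    {Y : ModuleCat.{u} Λ}
    (hY : ∀ (F : FGModuleCat.{u} Λ) (f : F.obj ⟶ Y), FactorsThrough P f) (k : ℕ) :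
    ∀ (X : FGModuleCat.{u} Λ), (∀ N, P N → Subsingleton (Ext.{u} X N (k + 1))) →
      Subsingleton (Ext.{u} X.obj Y (k + 1)) := by
  induction k with
  | zero =>
    intro X hX
    obtain ⟨S, hS, rfl, m, hm⟩ := FGModuleCat.exists_shortExact_free X
    have hS' := hS.map_of_exact (forget₂ (FGModuleCat.{u} Λ) (ModuleCat.{u} Λ))
    have : Projective (S.X₂.obj) := by rw [hm]; exact ModuleCat.projective_of_free (Pi.basisFun Λ _)
    refine hS'.subsingleton_ext_one_of_extension Y (fun f => ?_)
      (Ext.subsingleton_of_projective S.X₂.obj Y 0)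
    obtain ⟨N, g, h, hN, rfl⟩ := hY S.X₁ f
    obtain ⟨e, he⟩ := hS.exists_extension N (hX N hN) (ObjectProperty.homMk g)
    refine ⟨e.hom ≫ h, ?_⟩
    have : S.f.hom ≫ e.hom = g := congrArg (fun f => f.hom) he
    rw [← this]
    rfl
  | succ k ih =>
    intro X hX
    obtain ⟨S, hS, rfl, m, hm⟩ := FGModuleCat.exists_shortExact_free X
    have hS' := hS.map_of_exact (forget₂ (FGModuleCat.{u} Λ) (ModuleCat.{u} Λ))
    have : Projective (S.X₂.obj) := by rw [hm]; exact ModuleCat.projective_of_free (Pi.basisFun Λ _)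
    have : Projective S.X₂ := by rw [hm]; exact FGModuleCat.projective_of_fin m
    refine hS'.subsingleton_ext_of_right Y (ih S.X₁ fun N hN => ?_)
      (Ext.subsingleton_of_projective S.X₂.obj Y (k + 1))
    exact hS.subsingleton_ext_of_left N (hX N hN) (Ext.subsingleton_of_projective S.X₂ N k)

namespace IsClusterTilting

variable {n : ℕ} {M : ObjectProperty (FGModuleCat.{u} Λ)} (hM : IsClusterTilting.{u} M n)

include hM

lemma subsingleton_ext {X Y : FGModuleCat.{u} Λ} (hX : M X) (hY : M Y) {i : ℕ} (hi : 0 < i)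
    (hin : i < n) : Subsingleton (Ext.{u} X Y i) := by
  rw [← hM.leftPerp_eq] at hX
  exact hX hY i hi hin

lemma of_projective (P : FGModuleCat.{u} Λ) [Projective P] : M P := by
  rw [← hM.leftPerp_eq]
  intro Y _ i hi _
  obtain ⟨k, rfl⟩ := Nat.exists_eq_succ_of_ne_zero hi.ne'
  exact Ext.subsingleton_of_projective P Y k

lemma biprod {X Y : FGModuleCat.{u} Λ} (hX : M X) (hY : M Y) : M (X ⊞ Y) := by
  rw [← hM.leftPerp_eq] at hX hY ⊢
  intro Z hZ i hi hin
  have := hX hZ i hi hin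
  have := hY hZ i hi hin
  exact Ext.biprodAddEquiv.toEquiv.subsingleton

lemma factorsThrough_zero (F : FGModuleCat.{u} Λ) (X : ModuleCat.{u} Λ) :
    FactorsThrough M (0 : F.obj ⟶ X) := by
  obtain ⟨N, p, hN, _⟩ := hM.generating F
  exact ⟨N, 0, 0, hN, by simp⟩

lemma factorsThrough_add {F : FGModuleCat.{u} Λ} {X : ModuleCat.{u} Λ} {f f' : F.obj ⟶ X}
    (hf : FactorsThrough M f) (hf' : FactorsThrough M f') : FactorsThrough M (f + f') := by
  obtain ⟨N, g, h, hN, rfl⟩ := hf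
  obtain ⟨N', g', h', hN', rfl⟩ := hf'
  let l : F ⟶ N ⊞ N' := biprod.lift (ObjectProperty.homMk g) (ObjectProperty.homMk g')
  have h₁ : l.hom ≫ (biprod.fst : N ⊞ N' ⟶ N).hom = g :=
    congrArg (fun f => f.hom) (biprod.lift_fst (ObjectProperty.homMk g) (ObjectProperty.homMk g'))
  have h₂ : l.hom ≫ (biprod.snd : N ⊞ N' ⟶ N').hom = g' :=
    congrArg (fun f => f.hom) (biprod.lift_snd (ObjectProperty.homMk g) (ObjectProperty.homMk g'))
  refine ⟨N ⊞ N', l.hom, (biprod.fst : N ⊞ N' ⟶ N).hom ≫ h + (biprod.snd : N ⊞ N' ⟶ N').hom ≫ h',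
    hM.biprod hN hN', ?_⟩
  rw [Preadditive.comp_add, ← Category.assoc, ← Category.assoc, h₁, h₂]

lemma factorsThrough_sum {F : FGModuleCat.{u} Λ} {X : ModuleCat.{u} Λ} {ι : Type*}
    (s : Finset ι) (f : ι → (F.obj ⟶ X)) (hf : ∀ i ∈ s, FactorsThrough M (f i)) :
    FactorsThrough M (∑ i ∈ s, f i) := by
  classical
  induction s using Finset.induction_on with
  | empty => simpa using hM.factorsThrough_zero F X
  | insert a s ha ih =>
    rw [Finset.sum_insert ha]
    exact hM.factorsThrough_add (hf a (by simp)) (ih fun i hi => hf i (by simp [hi]))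

lemma exists_mono_leftApproximation (F : FGModuleCat.{u} Λ) :
    ∃ (N : FGModuleCat.{u} Λ) (θ : F ⟶ N), IsLeftApproximation M θ ∧ Mono θ := by
  obtain ⟨N, θ, hθ⟩ := hM.functoriallyFinite.2 F
  obtain ⟨N', i, hN', _⟩ := hM.cogenerating F
  obtain ⟨g, rfl⟩ := hθ.2 hN' i
  exact ⟨N, θ, hθ, mono_of_mono θ g⟩

/-- The cokernel of a monic left approximation gains one degree of vanishing: the approximation
property gives Ext^1, and dimension shifting gives the rest. -/
lemma exists_cosyzygy (F : FGModuleCat.{u} Λ) {j : ℕ} (hj : j + 1 < n)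
    (hF : ∀ Y, M Y → ∀ i, 0 < i → i ≤ j → Subsingleton (Ext.{u} F Y i)) :
    ∃ (S : ShortComplex (FGModuleCat.{u} Λ)), S.ShortExact ∧ S.X₁ = F ∧ M S.X₂ ∧
      ∀ Y, M Y → ∀ i, 0 < i → i ≤ j + 1 → Subsingleton (Ext.{u} S.X₃ Y i) := by
  obtain ⟨N, θ, hθ, _⟩ := hM.exists_mono_leftApproximation F
  let S := ShortComplex.mk θ (cokernel.π θ) (cokernel.condition θ)
  have hS : S.ShortExact := { exact := ShortComplex.exact_cokernel θ }
  refine ⟨S, hS, rfl, hθ.1, fun Y hY i hi hij => ?_⟩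
  obtain ⟨k, rfl⟩ := Nat.exists_eq_succ_of_ne_zero hi.ne'
  rcases Nat.eq_zero_or_pos k with rfl | hk
  · exact hS.subsingleton_ext_one_of_extension Y (hθ.2 hY)
      (hM.subsingleton_ext hθ.1 hY zero_lt_one (by lia))
  · exact hS.subsingleton_ext_of_right Y (hF Y hY k hk (by lia))
      (hM.subsingleton_ext hθ.1 hY hi (by lia))

/-- Here d = n - 1 - j counts the cosyzygies still to be taken; at d = 0 the vanishing hypothesis
puts C itself in M. -/
lemma subsingleton_ext_of_rightPerp {X : ModuleCat.{u} Λ} (hX : rightPerp.{u} (inMod M) n X)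
    (d : ℕ) : ∀ (j : ℕ), 0 < j → j + d + 1 = n → ∀ (C : FGModuleCat.{u} Λ),
      (∀ Y, M Y → ∀ i, 0 < i → i ≤ j → Subsingleton (Ext.{u} C Y i)) →
        Subsingleton (Ext.{u} C.obj X j) := by
  induction d with
  | zero =>
    intro j hj hjn C hC
    have : M C := by
      rw [← hM.leftPerp_eq]
      exact fun Y hY i hi hin => hC Y hY i hi (by lia)
    exact hX (M.prop_map_obj _ this) j hj (by lia)
  | succ d ih =>
    intro j hj hjn C hC
    obtain ⟨S, hS, rfl, hS₂, hS₃⟩ := hM.exists_cosyzygy C (j := j) (by lia) hC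
    have hS' := hS.map_of_exact (forget₂ (FGModuleCat.{u} Λ) (ModuleCat.{u} Λ))
    exact hS'.subsingleton_ext_of_left X (ih (j + 1) (by lia) (by lia) S.X₃ hS₃)
      (hX (M.prop_map_obj _ hS₂) j hj (by lia))

lemma rightPerp_le_limClosure (hn : 2 ≤ n) : rightPerp.{u} (inMod M) n ≤ limClosure M := by
  intro X hX
  rw [limClosure_iff_factors]
  intro F f
  obtain ⟨S, hS, rfl, hS₂, hS₃⟩ := hM.exists_cosyzygy F (j := 0) (by lia)
    (fun _ _ i hi hi' => absurd hi' (by lia))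
  have hS' := hS.map_of_exact (forget₂ (FGModuleCat.{u} Λ) (ModuleCat.{u} Λ))
  obtain ⟨g, hg⟩ := hS'.exists_extension X
    (hM.subsingleton_ext_of_rightPerp hX (n - 2) 1 zero_lt_one (by lia) S.X₃ hS₃) f
  exact ⟨S.X₂, S.f.hom, g, hS₂, hg⟩

lemma subsingleton_ext_limClosure {X : FGModuleCat.{u} Λ} (hX : M X) {Y : ModuleCat.{u} Λ}
    (hY : limClosure M Y) {i : ℕ} (hi : 0 < i) (hin : i < n) :
    Subsingleton (Ext.{u} X.obj Y i) := by
  obtain ⟨k, rfl⟩ := Nat.exists_eq_succ_of_ne_zero hi.ne'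
  exact subsingleton_ext_of_factorsThrough M (limClosure_iff_factors.1 hY) k X
    fun N hN => hM.subsingleton_ext hX hN hi hin

end IsClusterTilting

end

/-! ### Ext out of retracts and coproducts. -/

section

variable {A : Type u} [Category.{v} A] [Abelian A] [HasExt.{w} A]

lemma CategoryTheory.Retract.subsingleton_ext {X X' : A} (r : Retract X X') (Y : A) {i : ℕ}
    (h : Subsingleton (Ext.{w} X' Y i)) : Subsingleton (Ext.{w} X Y i) := by
  refine subsingleton_of_forall_eq 0 fun x => ?_
  rw [← Ext.mk₀_id_comp x, ← r.retract, ← Ext.mk₀_comp_mk₀_assoc,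
    Subsingleton.elim ((Ext.mk₀ r.r).comp x (zero_add i)) 0, Ext.comp_zero]

/-- Embedding Y in an injective turns degree one into a lifting problem, solved componentwise;
higher degrees shift to the cosyzygy of Y. -/
lemma subsingleton_ext_coproduct [EnoughInjectives A] {I : Type*} (X : I → A) [HasCoproduct X]
    (k : ℕ) : ∀ (Y : A), (∀ i, Subsingleton (Ext.{w} (X i) Y (k + 1))) →
      Subsingleton (Ext.{w} (∐ X) Y (k + 1)) := by
  induction k with
  | zero =>
    intro Y hY
    let S := ShortComplex.mk (Injective.ι Y) (cokernel.π _) (cokernel.condition _)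
    have hS : S.ShortExact := { exact := ShortComplex.exact_cokernel _ }
    refine hS.subsingleton_ext_one_of_lift _ (fun f => ?_)
      (Ext.subsingleton_of_injective _ (Injective.under Y) 0)
    choose g hg using fun i => hS.exists_lift (X i) (hY i) (Sigma.ι X i ≫ f)
    exact ⟨Sigma.desc g, Sigma.hom_ext _ _ fun i => by rw [Sigma.ι_desc_assoc, hg]⟩
  | succ k ih =>
    intro Y hY
    let S := ShortComplex.mk (Injective.ι Y) (cokernel.π _) (cokernel.condition _)
    have hS : S.ShortExact := { exact := ShortComplex.exact_cokernel _ }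
    refine hS.subsingleton_ext_left _ (ih S.X₃ fun i => ?_)
      (Ext.subsingleton_of_injective _ (Injective.under Y) (k + 1))
    exact hS.subsingleton_ext_right _ (Ext.subsingleton_of_injective _ (Injective.under Y) k)
      (hY i)

end

/-! ### Presentations by coproducts of objects of M, and closure properties of L. -/

section

variable {Λ : Type u} [Ring Λ] [IsNoetherianRing Λ]

/-- Representatives of the isomorphism classes of finitely generated modules. -/
noncomputable def finiteRepr (x : Σ m : ℕ, Submodule Λ (Fin m → Λ)) : FGModuleCat.{u} Λ :=
  FGModuleCat.of Λ ((Fin x.1 → Λ) ⧸ x.2)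

omit [IsNoetherianRing Λ] in
lemma exists_iso_finiteRepr (F : FGModuleCat.{u} Λ) : ∃ x, Nonempty (F ≅ finiteRepr x) := by
  obtain ⟨m, q, hq⟩ := Module.Finite.exists_fin' Λ F
  exact ⟨⟨m, LinearMap.ker q⟩, ⟨(q.quotKerEquivOfSurjective hq).symm.toFGModuleCatIso⟩⟩

namespace IsClusterTilting

variable {n : ℕ} {M : ObjectProperty (FGModuleCat.{u} Λ)} (hM : IsClusterTilting.{u} M n)

include hM

lemma of_iso {X Y : FGModuleCat.{u} Λ} (e : X ≅ Y) (hX : M X) : M Y := by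
  rw [← hM.leftPerp_eq] at hX ⊢
  exact fun Z hZ i hi hin => (Retract.ofIso e.symm).subsingleton_ext Z (hX hZ i hi hin)

lemma factorsThrough_coproduct {F : FGModuleCat.{u} Λ} {I : Type u} (N : I → FGModuleCat.{u} Λ)
    (hN : ∀ i, M (N i)) (f : F.obj ⟶ ∐ fun i => (N i).obj) : FactorsThrough M f := by
  classical
  let e := ModuleCat.coprodIsoDirectSum fun i => (N i).obj
  let D : ModuleCat.{u} Λ := ModuleCat.of Λ (DirectSum I fun i => (N i).obj)
  suffices h : FactorsThrough M (f ≫ e.hom) by simpa using h.postcomp e.inv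
  generalize f ≫ e.hom = f
  obtain ⟨m, x, hx⟩ := Module.Finite.exists_fin (R := Λ) (M := F)
  let s : Finset I := Finset.univ.biUnion fun j => (f.hom (x j)).support
  let π (i : I) : D ⟶ (N i).obj := ModuleCat.ofHom (DirectSum.component Λ I (fun i => (N i).obj) i)
  let ι (i : I) : (N i).obj ⟶ D := ModuleCat.ofHom (DirectSum.lof Λ I (fun i => (N i).obj) i)
  have hf : f = ∑ i ∈ s, (f ≫ π i) ≫ ι i := by
    apply ModuleCat.hom_ext
    refine LinearMap.ext_on_range hx fun j => ?_
    rw [ModuleCat.hom_sum, LinearMap.sum_apply]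
    have hs : (f.hom (x j)).support ⊆ s :=
      Finset.subset_biUnion_of_mem (fun j => (f.hom (x j)).support) (Finset.mem_univ j)
    refine (DirectSum.sum_support_of (f.hom (x j))).symm.trans
      (Finset.sum_subset hs fun i _ hi => ?_)
    rw [DFinsupp.notMem_support_iff.1 hi, map_zero]
  rw [hf]
  exact hM.factorsThrough_sum s _ fun i _ => ⟨N i, f ≫ π i, ι i, hN i, rfl⟩

/-- Every module is a quotient of a coproduct of objects of `M`, in such a way that morphisms
factoring through `M` lift. -/
lemma exists_shortExact_coproduct (X : ModuleCat.{u} Λ) :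
    ∃ (S : ShortComplex (ModuleCat.{u} Λ)), S.ShortExact ∧ S.X₃ = X ∧
      (∃ (I : Type u) (N : I → FGModuleCat.{u} Λ), (∀ i, M (N i)) ∧
        S.X₂ = ∐ fun i => (N i).obj) ∧
      ∀ (F : ModuleCat.{u} Λ) (f : F ⟶ S.X₃), FactorsThrough M f → ∃ g : F ⟶ S.X₂, g ≫ S.g = f := by
  -- One summand for every morphism to X from a representative of an object of M; surjectivity holds
  -- because Λ lies in M.
  let I := Σ x : (Σ m : ℕ, Submodule Λ (Fin m → Λ)),
    {_f : (finiteRepr x).obj ⟶ X // M (finiteRepr x)}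
  let N (i : I) : FGModuleCat.{u} Λ := finiteRepr i.1
  let π : (∐ fun i => (N i).obj) ⟶ X := Sigma.desc fun i => i.2.1
  have hlift (F : ModuleCat.{u} Λ) (f : F ⟶ X) (hf : FactorsThrough M f) : ∃ g, g ≫ π = f := by
    obtain ⟨K, g, h, hK, rfl⟩ := hf
    obtain ⟨x, ⟨e⟩⟩ := exists_iso_finiteRepr K
    let i : I := ⟨x, e.inv.hom ≫ h, hM.of_iso e hK⟩
    refine ⟨g ≫ e.hom.hom ≫ Sigma.ι (fun i => (N i).obj) i, ?_⟩
    have h₁ : Sigma.ι (fun i => (N i).obj) i ≫ π = e.inv.hom ≫ h := Sigma.ι_desc _ _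
    have h₂ : e.hom.hom ≫ e.inv.hom = 𝟙 _ := congrArg (fun f => f.hom) e.hom_inv_id
    rw [Category.assoc, Category.assoc, h₁, reassoc_of% h₂]
  have : Epi π := by
    rw [ModuleCat.epi_iff_surjective]
    intro x
    have := FGModuleCat.projective_of_fin (Λ := Λ) 1
    let P := FGModuleCat.of Λ (Fin 1 → Λ)
    let f : P.obj ⟶ X := ModuleCat.ofHom (Fintype.linearCombination Λ fun _ => x)
    obtain ⟨g, hg⟩ := hlift P.obj f ⟨P, 𝟙 _, f, hM.of_projective P, by simp⟩
    refine ⟨g (fun _ => 1 : Fin 1 → Λ), ?_⟩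
    refine (ConcreteCategory.congr_hom hg (fun _ => 1 : Fin 1 → Λ)).trans ?_
    change Fintype.linearCombination Λ (fun _ : Fin 1 => x) (fun _ => 1) = x
    simp [Fintype.linearCombination_apply]
  exact ⟨ShortComplex.mk (kernel.ι π) π (kernel.condition π),
    { exact := ShortComplex.exact_kernel π }, rfl, ⟨I, N, fun i => i.2.2, rfl⟩, hlift⟩

lemma limClosure_coproduct {I : Type u} (N : I → FGModuleCat.{u} Λ)
    (hN : ∀ i, M (N i)) : limClosure M (∐ fun i => (N i).obj) :=
  limClosure_iff_factors.2 fun _ f => hM.factorsThrough_coproduct N hN f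

lemma isGenerating_limClosure : IsGeneratingSubcategory (limClosure M) := by
  intro X
  obtain ⟨S, hS, rfl, ⟨I, N, hN, h₂⟩, -⟩ := hM.exists_shortExact_coproduct X
  exact ⟨S.X₂, S.g, h₂ ▸ hM.limClosure_coproduct N hN, hS.epi_g⟩

lemma isCogenerating_limClosure (hn : 2 ≤ n) : IsCogeneratingSubcategory (limClosure M) := by
  intro X
  refine ⟨Injective.under X, Injective.ι X, hM.rightPerp_le_limClosure hn _ fun Y _ i hi _ => ?_,
    inferInstance⟩
  obtain ⟨k, rfl⟩ := Nat.exists_eq_succ_of_ne_zero hi.ne'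
  exact Ext.subsingleton_of_injective Y _ k

lemma subsingleton_ext_coproduct {I : Type u} (N : I → FGModuleCat.{u} Λ)
    (hN : ∀ i, M (N i)) {Y : ModuleCat.{u} Λ} (hY : limClosure M Y) {i : ℕ} (hi : 0 < i)
    (hin : i < n) : Subsingleton (Ext.{u} (∐ fun i => (N i).obj) Y i) := by
  obtain ⟨k, rfl⟩ := Nat.exists_eq_succ_of_ne_zero hi.ne'
  exact _root_.subsingleton_ext_coproduct _ k Y
    fun j => hM.subsingleton_ext_limClosure (hN j) hY hi hin

lemma subsingleton_ext_addClosure {X Y : ModuleCat.{u} Λ} (hX : addClosure M X)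
    (hY : limClosure M Y) {i : ℕ} (hi : 0 < i) (hin : i < n) : Subsingleton (Ext.{u} X Y i) := by
  obtain ⟨I, N, hN, ⟨r⟩⟩ := hX
  exact r.subsingleton_ext Y (hM.subsingleton_ext_coproduct N hN hY hi hin)

omit hM in
/-- Membership in `lim→ M` is an injectivity condition. -/
lemma exists_extension_of_limClosure {X : ModuleCat.{u} Λ} (hX : limClosure M X)
    {F N : FGModuleCat.{u} Λ} {θ : F ⟶ N} (hθ : IsLeftApproximation M θ) (f : F.obj ⟶ X) :
    ∃ g : N.obj ⟶ X, θ.hom ≫ g = f := by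
  obtain ⟨K, g, h, hK, rfl⟩ := limClosure_iff_factors.1 hX F f
  obtain ⟨k, hk⟩ := hθ.2 hK (ObjectProperty.homMk g)
  refine ⟨k.hom ≫ h, ?_⟩
  have : θ.hom ≫ k.hom = g := congrArg (fun f => f.hom) hk
  rw [reassoc_of% this]

lemma limClosure_of_isPureMono {X Y : ModuleCat.{u} Λ} {i : X ⟶ Y} (hi : IsPureMono i.hom)
    (hY : limClosure M Y) : limClosure M X := by
  rw [limClosure_iff_factors]
  intro F f
  obtain ⟨N, θ, hθ⟩ := hM.functoriallyFinite.2 F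
  obtain ⟨g, hg⟩ := exists_extension_of_limClosure hY hθ (f ≫ i)
  obtain ⟨k, hk⟩ := hi (F := F.obj) (G := N.obj) F.2 N.2 θ.hom.hom f.hom g.hom
    (congrArg ModuleCat.Hom.hom hg)
  exact ⟨N, θ.hom, ModuleCat.ofHom k, hθ.1, ModuleCat.hom_ext hk⟩

omit hM in
lemma limClosure_of_pure_quotient {S : ShortComplex (ModuleCat.{u} Λ)} (hS : S.ShortExact)
    (hpure : IsPureMono S.f.hom) (h₂ : limClosure M S.X₂) : limClosure M S.X₃ := by
  rw [limClosure_iff_factors] at h₂ ⊢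
  intro F f
  obtain ⟨g, hg⟩ := hpure.exists_lift (p := S.g.hom)
    ((ShortComplex.ShortExact.moduleCat_exact_iff_function_exact S).1 hS.exact)
    hS.moduleCat_surjective_g (Q := F.obj) f.hom
  have : f = ModuleCat.ofHom g ≫ S.g := ModuleCat.hom_ext hg.symm
  rw [this]
  exact FactorsThrough.postcomp (h₂ F _) _

/-- Since Ext^1(N, S.X₁) = 0, the factorization of f ≫ S.g through N lifts to S.X₂. It differs from
f by a morphism into S.X₁, and sums of morphisms factoring through M factor through M. -/
lemma limClosure_extension {S : ShortComplex (ModuleCat.{u} Λ)} (hS : S.ShortExact)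
    (h₁ : limClosure M S.X₁) (h₃ : limClosure M S.X₃) (hn : 1 < n) : limClosure M S.X₂ := by
  rw [limClosure_iff_factors]
  intro F f
  obtain ⟨N, g, h, hN, hgh⟩ := limClosure_iff_factors.1 h₃ F (f ≫ S.g)
  obtain ⟨k, hk⟩ := hS.exists_lift N.obj
    (hM.subsingleton_ext_limClosure hN h₁ zero_lt_one hn) h
  have := hS.mono_f
  let d : F.obj ⟶ S.X₁ := hS.exact.lift (f - g ≫ k) (by simp [hk, hgh])
  have hd : d ≫ S.f = f - g ≫ k := hS.exact.lift_f _ _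
  have hf : f = d ≫ S.f + g ≫ k := by rw [hd, sub_add_cancel]
  rw [hf]
  exact hM.factorsThrough_add (FactorsThrough.postcomp (limClosure_iff_factors.1 h₁ F d) _)
    ⟨N, g, k, hN, rfl⟩

lemma limClosure_doubleDual {X : ModuleCat.{u} Λ} (hX : limClosure M X) :
    limClosure M (ModuleCat.of Λ (DoubleDual X)) := by
  rw [limClosure_iff_factors]
  intro F f
  obtain ⟨N, θ, hθ⟩ := hM.functoriallyFinite.2 F
  obtain ⟨d, hd⟩ := DoubleDual.exists_extension (L := X) (F := F.obj) (G := N.obj) θ.hom.hom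
    (fun a => by
      obtain ⟨g, hg⟩ := exists_extension_of_limClosure hX hθ (ModuleCat.ofHom a)
      exact ⟨g.hom, congrArg ModuleCat.Hom.hom hg⟩) f.hom
  exact ⟨N, θ.hom, ModuleCat.ofHom d, hθ.1, ModuleCat.hom_ext hd⟩

end IsClusterTilting

end

/-! ### Short exact sequences from pushouts. -/

namespace CategoryTheory.ShortComplex.ShortExact

variable {A : Type u} [Category.{v} A] [Abelian A]

lemma pushout_inr {T : ShortComplex A} (hT : T.ShortExact) {C : A} (i : T.X₁ ⟶ C) :
    (ShortComplex.mk (pushout.inr T.f i)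
      (pushout.desc T.g (0 : C ⟶ T.X₃) (by rw [T.zero, comp_zero]))
      (by rw [pushout.inr_desc])).ShortExact := by
  have := hT.mono_f
  have := hT.epi_g
  have hπ : Epi (pushout.desc T.g (0 : C ⟶ T.X₃) (by rw [T.zero, comp_zero]) :
      pushout T.f i ⟶ T.X₃) :=
    epi_of_epi_fac (pushout.inl_desc T.g (0 : C ⟶ T.X₃) _)
  refine { exact := ShortComplex.exact_of_g_is_cokernel _ (CokernelCofork.IsColimit.ofπ' _ _ ?_),
           mono_f := inferInstanceAs (Mono (pushout.inr T.f i)), epi_g := hπ }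
  intro Z m hm
  have h : T.f ≫ pushout.inl T.f i ≫ m = 0 := by
    rw [pushout.condition_assoc]; exact (congrArg (i ≫ ·) hm).trans comp_zero
  refine ⟨hT.exact.desc _ h, pushout.hom_ext ?_ ?_⟩
  · exact (pushout.inl_desc_assoc _ _ _ _).trans (hT.exact.g_desc _ h)
  · exact (pushout.inr_desc_assoc _ _ _ _).trans (zero_comp.trans hm.symm)

lemma pushout_inl {T : ShortComplex A} (hT : T.ShortExact) {C : A} (e : T.X₂ ⟶ C) [Mono e] :
    (ShortComplex.mk (T.f ≫ e) (pushout.inl e T.g)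
      (by rw [Category.assoc, pushout.condition, T.zero_assoc, zero_comp])).ShortExact := by
  have := hT.mono_f
  have := hT.epi_g
  refine { exact := ShortComplex.exact_of_g_is_cokernel _ (CokernelCofork.IsColimit.ofπ' _ _ ?_),
           mono_f := mono_comp _ _, epi_g := inferInstanceAs (Epi (pushout.inl e T.g)) }
  intro Z m hm
  have h : T.f ≫ e ≫ m = 0 := by simpa using hm
  exact ⟨pushout.desc m (hT.exact.desc _ h) (hT.exact.g_desc _ h).symm, pushout.inl_desc _ _ _⟩

end CategoryTheory.ShortComplex.ShortExact

/-! ### Special preenvelopes and right approximations. -/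

section

variable {Λ : Type u} [Ring Λ] [IsNoetherianRing Λ]

/-- `X` embeds, with cokernel in `L`, in a module `C` with `Ext^i(L, C) = 0` for `0 < i ≤ j`. -/
def HasSpecialPreenvelope (L : ObjectProperty (ModuleCat.{u} Λ)) (j : ℕ) (X : ModuleCat.{u} Λ) :
    Prop :=
  ∃ (C Q : ModuleCat.{u} Λ) (i : X ⟶ C) (p : C ⟶ Q) (w : i ≫ p = 0),
    (ShortComplex.mk i p w).ShortExact ∧ L Q ∧
      ∀ Y, L Y → ∀ k, 0 < k → k ≤ j → Subsingleton (Ext.{u} Y C k)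

namespace IsClusterTilting

variable {n : ℕ} {M : ObjectProperty (FGModuleCat.{u} Λ)} (hM : IsClusterTilting.{u} M n)

include hM

lemma exists_pure_presentation {Y : ModuleCat.{u} Λ} (hY : limClosure M Y) :
    ∃ (S : ShortComplex (ModuleCat.{u} Λ)), S.ShortExact ∧ S.X₃ = Y ∧
      (∃ (I : Type u) (N : I → FGModuleCat.{u} Λ), (∀ i, M (N i)) ∧
        S.X₂ = ∐ fun i => (N i).obj) ∧ IsPureMono S.f.hom := by
  obtain ⟨S, hS, rfl, hN, hlift⟩ := hM.exists_shortExact_coproduct Y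
  refine ⟨S, hS, rfl, hN, isPureMono_of_lift (p := S.g.hom) hS.moduleCat_injective_f
    ((ShortComplex.ShortExact.moduleCat_exact_iff_function_exact S).1 hS.exact)
    fun Q hQ f => ?_⟩
  obtain ⟨g, hg⟩ := hlift Q (ModuleCat.ofHom f)
    (limClosure_iff_factors.1 hY ⟨Q, hQ⟩ (ModuleCat.ofHom f))
  exact ⟨g.hom, congrArg ModuleCat.Hom.hom hg⟩

/-- Degree one is pure-injectivity applied to a pure presentation of Y. The kernel of that
presentation is a pure submodule of an object of L, so it lies in L and the induction shifts along
it. -/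
lemma subsingleton_ext_doubleDual {X : ModuleCat.{u} Λ} (hX : limClosure M X) (k : ℕ) :
    k + 1 < n → ∀ Y : ModuleCat.{u} Λ, limClosure M Y →
      Subsingleton (Ext.{u} Y (ModuleCat.of Λ (DoubleDual X)) (k + 1)) := by
  induction k with
  | zero =>
    intro hk Y hY
    obtain ⟨S, hS, rfl, ⟨I, N, hN, h₂⟩, hpure⟩ := hM.exists_pure_presentation hY
    refine hS.subsingleton_ext_one_of_extension _ (fun f => ?_)
      (h₂ ▸ hM.subsingleton_ext_coproduct N hN (hM.limClosure_doubleDual hX) zero_lt_one hk)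
    obtain ⟨g, hg⟩ := hpure.exists_extension_doubleDual f.hom
    exact ⟨ModuleCat.ofHom g, ModuleCat.hom_ext hg⟩
  | succ k ih =>
    intro hk Y hY
    obtain ⟨S, hS, rfl, ⟨I, N, hN, h₂⟩, hpure⟩ := hM.exists_pure_presentation hY
    exact hS.subsingleton_ext_of_right _ (ih (by lia) S.X₁ (hM.limClosure_of_isPureMono hpure
      (h₂ ▸ hM.limClosure_coproduct N hN)))
      (h₂ ▸ hM.subsingleton_ext_coproduct N hN (hM.limClosure_doubleDual hX) (Nat.succ_pos _) hk)

lemma exists_doubleDual_shortExact {X : ModuleCat.{u} Λ} (hX : limClosure M X) :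
    ∃ (C Q : ModuleCat.{u} Λ) (i : X ⟶ C) (p : C ⟶ Q) (w : i ≫ p = 0),
      (ShortComplex.mk i p w).ShortExact ∧ limClosure M Q ∧
        ∀ Y, limClosure M Y → ∀ k, 0 < k → k < n → Subsingleton (Ext.{u} Y C k) := by
  let C := ModuleCat.of Λ (DoubleDual X)
  let i : X ⟶ C := ModuleCat.ofHom (DoubleDual.eval Λ X)
  have hi : IsPureMono i.hom := DoubleDual.isPureMono_eval Λ X
  have : Mono i := (ModuleCat.mono_iff_injective i).2 hi.injective
  have hS : (ShortComplex.mk i (cokernel.π i) (cokernel.condition i)).ShortExact :=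
    { exact := ShortComplex.exact_cokernel i }
  refine ⟨C, _, i, _, _, hS, limClosure_of_pure_quotient hS hi (hM.limClosure_doubleDual hX),
    fun Y hY k hk hkn => ?_⟩
  obtain ⟨k, rfl⟩ := Nat.exists_eq_succ_of_ne_zero hk.ne'
  exact hM.subsingleton_ext_doubleDual hX k hkn Y hY

/-- A special preenvelope of `T.X₁` yields a special precover of `T.X₃`. -/
lemma exists_special_precover {T : ShortComplex (ModuleCat.{u} Λ)} (hT : T.ShortExact)
    (h₂ : limClosure M T.X₂) (hn : 1 < n) {j : ℕ}
    (hK : HasSpecialPreenvelope (limClosure M) j T.X₁) :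
    ∃ (S : ShortComplex (ModuleCat.{u} Λ)), S.ShortExact ∧ S.X₃ = T.X₃ ∧ limClosure M S.X₂ ∧
      ∀ Y, limClosure M Y → ∀ k, 0 < k → k ≤ j → Subsingleton (Ext.{u} Y S.X₁ k) := by
  obtain ⟨C, Q, i, p, w, hS, hQ, hC⟩ := hK
  -- The pushout of T.X₂ and C over T.X₁ is an extension of Q by T.X₂, hence in L; it is also an
  -- extension of T.X₃ by C.
  have h := hS.pushout_inr T.f
  refine ⟨_, hT.pushout_inr i, rfl, ?_, hC⟩
  exact ObjectProperty.prop_of_iso (ObjectProperty.ind.{u} (inMod M)) (pushoutSymmetry i T.f)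
    (hM.limClosure_extension h h₂ hQ hn)

/-- Take a special precover S.X₂ → T.X₃, embed S.X₂ in its double dual C, and push out to P. Then
T.X₃ → P has cokernel in L, and 0 → S.X₁ → C → P → 0 bounds Ext^k(-, P) by Ext^{k+1}(-, S.X₁), which
costs one degree. -/
lemma hasSpecialPreenvelope_of_shortExact {T : ShortComplex (ModuleCat.{u} Λ)} (hT : T.ShortExact)
    (h₂ : limClosure M T.X₂) (hn : 1 < n) {j : ℕ} (hj : j < n)
    (hK : HasSpecialPreenvelope (limClosure M) (j + 1) T.X₁) :
    HasSpecialPreenvelope (limClosure M) j T.X₃ := by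
  obtain ⟨S, hS, h₃, hS₂, hS₁⟩ := hM.exists_special_precover hT h₂ hn hK
  rw [← h₃]
  obtain ⟨C, Q, e, p, w, hE, hQ, hC⟩ := hM.exists_doubleDual_shortExact hS₂
  have : Mono e := hE.mono_f
  refine ⟨_, Q, _, _, _, hE.pushout_inr S.g, hQ, fun Y hY k hk hkj => ?_⟩
  exact (hS.pushout_inl e).subsingleton_ext_right Y (hC Y hY k hk (by lia))
    (hS₁ Y hY (k + 1) (by lia) (by lia))

/-- Downward induction on j from n - 1, where X lies in L by (d). For smaller j, the kernel of a
coproduct presentation of X has vanishing up to j + 1, regaining the degree lost in the pushouts. -/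
lemma hasSpecialPreenvelope (hn : 2 ≤ n) (d : ℕ) : ∀ (j : ℕ), 0 < j → j + d + 1 = n →
    ∀ X : ModuleCat.{u} Λ, (∀ Y, M Y → ∀ i, 0 < i → i ≤ j → Subsingleton (Ext.{u} Y.obj X i)) →
      HasSpecialPreenvelope (limClosure M) j X := by
  induction d with
  | zero =>
    intro j hj hjn X hX
    have hX' : limClosure M X := by
      refine hM.rightPerp_le_limClosure hn X fun Y hY i hi hin => ?_
      obtain ⟨Z, hZ, ⟨e⟩⟩ := (M.prop_map_iff _ Y).1 hY
      exact (Retract.ofIso e.symm).subsingleton_ext X (hX Z hZ i hi (by lia))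
    obtain ⟨C, Q, i, p, w, h, hQ, hC⟩ := hM.exists_doubleDual_shortExact hX'
    exact ⟨C, Q, i, p, w, h, hQ, fun Y hY k hk hkj => hC Y hY k hk (by lia)⟩
  | succ d ih =>
    intro j hj hjn X hX
    obtain ⟨T, hT, rfl, ⟨I, N, hN, h₂⟩, hlift⟩ := hM.exists_shortExact_coproduct X
    have hT₂ : limClosure M T.X₂ := h₂ ▸ hM.limClosure_coproduct N hN
    refine hM.hasSpecialPreenvelope_of_shortExact hT hT₂ hn (by lia)
      (ih (j + 1) (by lia) (by lia) T.X₁ fun Y hY i hi hij => ?_)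
    obtain ⟨k, rfl⟩ := Nat.exists_eq_succ_of_ne_zero hi.ne'
    rcases Nat.eq_zero_or_pos k with rfl | hk
    · exact hT.subsingleton_ext_one_of_lift Y.obj
        (fun f => hlift _ f ⟨Y, 𝟙 _, f, hY, Category.id_comp f⟩)
        (hM.subsingleton_ext_limClosure hY hT₂ zero_lt_one (by lia))
    · exact hT.subsingleton_ext_left Y.obj (hX Y hY k hk (by lia))
        (hM.subsingleton_ext_limClosure hY hT₂ hi (by lia))

lemma isContravariantlyFinite_limClosure (hn : 2 ≤ n) :
    IsContravariantlyFinite (limClosure M) := by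
  intro X
  obtain ⟨T, hT, rfl, ⟨I, N, hN, h₂⟩, hlift⟩ := hM.exists_shortExact_coproduct X
  have hT₂ : limClosure M T.X₂ := h₂ ▸ hM.limClosure_coproduct N hN
  have hK : HasSpecialPreenvelope (limClosure M) 1 T.X₁ := by
    refine hM.hasSpecialPreenvelope hn (n - 2) 1 zero_lt_one (by lia) T.X₁ fun Y hY i hi hij => ?_
    obtain rfl : i = 1 := by lia
    exact hT.subsingleton_ext_one_of_lift Y.obj
      (fun f => hlift _ f ⟨Y, 𝟙 _, f, hY, Category.id_comp f⟩)
      (hM.subsingleton_ext_limClosure hY hT₂ zero_lt_one (by lia))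
  obtain ⟨S, hS, h₃, hS₂, hS₁⟩ := hM.exists_special_precover hT hT₂ hn hK
  rw [← h₃]
  exact ⟨S.X₂, S.g, hS₂, fun Z hZ f => hS.exists_lift Z (hS₁ Z hZ 1 zero_lt_one le_rfl) f⟩

/-! ### Left approximations by the small object argument. -/

section SmallObject

attribute [local instance] Cardinal.fact_isRegular_aleph0 Cardinal.orderBotAleph0OrdToType

open MorphismProperty

lemma isCovariantlyFinite_limClosure : IsCovariantlyFinite (limClosure M) := by
  choose N θ hθ using fun x => hM.functoriallyFinite.2 (finiteRepr (Λ := Λ) x)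
  let I : MorphismProperty (ModuleCat.{u} Λ) := MorphismProperty.ofHoms fun x => (θ x).hom
  have : IsSmall.{u} I := isSmall_ofHoms ..
  have : I.IsCardinalForSmallObjectArgument Cardinal.aleph0.{u} :=
    { preservesColimit := fun {A B X Y} i hi f hf => by
        have : IsFinitelyPresentable.{u} A := by
          obtain ⟨x⟩ := hi
          exact ModuleCat.isFinitelyPresentable_of_finite Λ (finiteRepr x).obj
        infer_instance }
  have : I.HasSmallObjectArgument := ⟨.aleph0, inferInstance, inferInstance, inferInstance⟩
  have hrlp {Z : ModuleCat.{u} Λ} (hZ : limClosure M Z) : I.rlp (terminal.from Z) := by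
    rintro A B _ ⟨x⟩
    refine ⟨fun {f _} sq => ?_⟩
    obtain ⟨g, hg⟩ := exists_extension_of_limClosure hZ (hθ x) f
    exact ⟨⟨{ l := g, fac_left := hg, fac_right := Subsingleton.elim _ _ }⟩⟩
  intro X
  -- The right factor makes `h.Z` injective for all the maps θ, hence an object of L; the left
  -- factor lifts against every object of L, which is the approximation property.
  let h := MorphismProperty.factorizationData I.rlp.llp I.rlp (terminal.from X)
  refine ⟨h.Z, h.i, limClosure_iff_factors.2 fun F f => ?_, fun Z hZ f => ?_⟩
  · obtain ⟨x, ⟨e⟩⟩ := exists_iso_finiteRepr F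
    have := h.hp _ (MorphismProperty.ofHoms.mk x : I (θ x).hom)
    have sq : CommSq (e.inv.hom ≫ f) (θ x).hom h.p (terminal.from (N x).obj) :=
      ⟨Subsingleton.elim _ _⟩
    refine ⟨N x, e.hom.hom ≫ (θ x).hom, sq.lift, (hθ x).1, ?_⟩
    have he : e.hom.hom ≫ e.inv.hom = 𝟙 _ := congrArg (fun f => f.hom) e.hom_inv_id
    rw [Category.assoc, sq.fac_left, reassoc_of% he]
  · have := h.hi _ (hrlp hZ)
    have sq : CommSq f h.i (terminal.from Z) (terminal.from h.Z) := ⟨Subsingleton.elim _ _⟩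
    exact ⟨sq.lift, sq.fac_left⟩

end SmallObject

end IsClusterTilting

end

theorem proposition2p1 {Λ : Type u} [Ring Λ] [IsArtinAlgebra Λ] (n : ℕ) (hn : 2 ≤ n)
    (M : ObjectProperty (FGModuleCat.{u} Λ)) (hM : IsClusterTilting.{u} M n) :
    (IsGeneratingSubcategory (limClosure M) ∧ IsCogeneratingSubcategory (limClosure M)) ∧
    IsFunctoriallyFinite (limClosure M) ∧
    (∀ k : ℕ, 1 ≤ k → k ≤ n - 1 → ∀ X Y : ModuleCat.{u} Λ, addClosure M X → limClosure M Y →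
      Subsingleton (Ext.{u} X Y k)) ∧
    rightPerp.{u} (inMod M) n ≤ limClosure M :=
  ⟨⟨hM.isGenerating_limClosure, hM.isCogenerating_limClosure hn⟩,
    ⟨hM.isContravariantlyFinite_limClosure hn, hM.isCovariantlyFinite_limClosure⟩,
    fun _ hk hkn _ _ hX hY => hM.subsingleton_ext_addClosure hX hY hk (by lia),
    hM.rightPerp_le_limClosure hn⟩
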